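/- Fix a signature $\mathcal{F}$ of function symbols with fixed finite arities and an infinite set $\mathcal{V}$ of variables. Equations $s \approx t$ and rules $s \to t$ are ordered pairs of terms in $\mathcal{T}(\mathcal{F},\mathcal{V})$. For a set $P$ of such pairs let $\to_P$ be its closure under contexts and substitutions, $\to_P^*$, $\leftrightarrow_P$ and $\leftrightarrow_P^*$ the reflexive-transitive, symmetric, and reflexive-symmetric-transitive closures of $\to_P$, and $s \downarrow_P t$ joinability, i.e. $s \to_P^* w$ and $t \to_P^* w$ for some $w$. Write $s \rhd t$ (proper encompassment) if some subterm of $s$ is a substitution instance of $t$, but no subterm of $t$ is an instance of $s$. Let $>$ be a reduction order, that is, a well-founded (strict) order on $\mathcal{T}(\mathcal{F},\mathcal{V})$ closed under contexts and substitutions. The inference system $\mathrm{KB}_i$ acts on pairs $(\mathcal{E},\mathcal{R})$ of a (possibly infinite) set of equations and a set of rules by the following steps ($\uplus$ is disjoint union): - deduce: $(\mathcal{E},\mathcal{R}) \vdash (\mathcal{E}\cup\{s\approx t\},\mathcal{R})$ if $c \to_{\mathcal{R}} s$ and $c \to_{\mathcal{R}} t$ for some term $c$; - orient: $(\mathcal{E}\uplus\{s\approx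 t\},\mathcal{R}) \vdash (\mathcal{E},\mathcal{R}\cup\{s\to t\})$ if $s>t$, and $(\mathcal{E}\uplus\{s\approx t\},\mathcal{R}) \vdash (\mathcal{E},\mathcal{R}\cup\{t\to s\})$ if $t>s$; - delete: $(\mathcal{E}\uplus\{s\approx s\},\mathcal{R}) \vdash (\mathcal{E},\mathcal{R})$; - compose: $(\mathcal{E},\mathcal{R}\uplus\{s\to t\}) \vdash (\mathcal{E},\mathcal{R}\cup\{s\to u\})$ if $t\to_{\mathcal{R}}u$; - simplify: $(\mathcal{E}\uplus\{s\approx t\},\mathcal{R}) \vdash (\mathcal{E}\cup\{u\approx t\},\mathcal{R})$ if $s\to_{\mathcal{R}}u$, and $(\mathcal{E}\uplus\{s\approx t\},\mathcal{R}) \vdash (\mathcal{E}\cup\{s\approx u\},\mathcal{R})$ if $t\to_{\mathcal{R}}u$; - collapse: $(\mathcal{E},\mathcal{R}\uplus\{t\to s\}) \vdash (\mathcal{E}\cup\{u\approx s\},\mathcal{R})$ if $t\to_{\mathcal{R}}u$ by a rule $\ell\to r\in\mathcal{R}$ with $t\rhd\ell$. Let $(\mathcal{E}_0,\mathcal{R}_0)\vdash(\mathcal{E}_1,\mathcal{R}_1)\vdash(\mathcal{E}_2,\mathcal{R}_2)\vdash\cdots$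 with $\mathcal{R}_0=\varnothing$ be a run, i.e. a maximal sequence of such steps: it is infinite, or it is finite and no step applies to its last member. Put $\mathcal{E}_\infty=\bigcup_i\mathcal{E}_i$, $\mathcal{E}_\omega=\bigcup_i\bigcap_{j\ge i}\mathcal{E}_j$ and $\mathcal{R}_\omega=\bigcup_i\bigcap_{j\ge i}\mathcal{R}_j$, the indices ranging over the members of the run. An overlap of a set of rules $\mathcal{R}$ consists of variants $\ell_1\to r_1$ and $\ell_2\to r_2$ (under bijective renamings of variables) of rules in $\mathcal{R}$ without common variables and a function symbol position $p$ of $\ell_2$ such that $\ell_1$ and $\ell_2|_p$ are unifiable and, if $p$ is the root position, the two rules are not variants of each other. If $\sigma$ is a most general unifier of $\ell_1$ and $\ell_2|_p$, then $(\ell_2\sigma[r_1\sigma]_p,\, r_2\sigma)$ is a critical pair of $\mathcal{R}$; it is prime if (for some such overlap and $\sigma$ yielding it) all proper subterms of $\ell_1\sigma$ are normal forms of $\to_{\mathcal{R}}$. Let $\mathrm{PCP}(\mathcal{R})$ be the set of prime critical pairs. **Theorem.** Suppose that the run is fair, that is, $\mathcal{E}_\omega=\varnothing$ and $\mathrm{PCP}(\mathcal{R}_\omega)\subseteq{\downarrow_{\mathcal{R}_\omega}}\cup{\leftrightarrow_{\mathcal{E}_\infty}}$.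 Then $\mathcal{R}_\omega$ is a complete presentation of $\mathcal{E}_0$: it is a term rewrite system (no left-hand side is a variable, and all variables of a right-hand side occur in the left-hand side), $\to_{\mathcal{R}_\omega}$ is well-founded (there are no infinite rewrite sequences) and confluent, and ${\leftrightarrow^*_{\mathcal{R}_\omega}}={\leftrightarrow^*_{\mathcal{E}_0}}$. -/

import Mathlib

universe u v w

namespace TermRewriting

open FirstOrder Relation

/-- Sets of ordered pairs of terms over the function symbols of `L` (of all arities) and the
variables `V`. They serve both as sets of equations `s ≈ t` and as sets of rules `s → t`. -/
abbrev PairSet (L : FirstOrder.Language.{u, v}) (V : Type w) : Type (max u w) :=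
  Set (L.Term V × L.Term V)

section Terms

variable {L : FirstOrder.Language.{u, v}} {V : Type w}

/-- The subterm `t|_p` of `t` at position `p`, and `none` if `p` is not a position of `t`.
Positions are strings of argument indices, counted from `0`. -/
def subtermAt : L.Term V → List ℕ → Option (L.Term V)
  | t, [] => some t
  | .var _, _ :: _ => none
  | .func (l := n) _ ts, i :: p => if h : i < n then subtermAt (ts ⟨i, h⟩) p else none

/-- The term `t[u]_p`: the subterm of `t` at position `p` is replaced by `u`. (The result is `t`
itself if `p` is not a position of `t`; it is only used at positions of `t`.) -/
def replaceAt : L.Term V → List ℕ → L.Term V → L.Term V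
  | _, [], u => u
  | .var x, _ :: _, _ => .var x
  | .func (l := n) f ts, i :: p, u =>
      if h : i < n then
        .func f (Function.update ts ⟨i, h⟩ (replaceAt (ts ⟨i, h⟩) p u))
      else .func f ts

/-- The set of positions of a term. -/
def positions (t : L.Term V) : Set (List ℕ) := {p | ∃ u, subtermAt t p = some u}

/-- The term is a variable. -/
def IsVar (t : L.Term V) : Prop := ∃ x : V, t = .var x

/-- The set of positions of a term that address function symbols. -/
def funPositions (t : L.Term V) : Set (List ℕ) := {p | ∃ u, subtermAt t p = some u ∧ ¬ IsVar u}

open scoped Classical in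
/-- The variables of a term. -/
noncomputable def vars (t : L.Term V) : Finset V := t.varFinset

open scoped Classical in
/-- The variables of a rule or an equation. -/
noncomputable def pairVars (e : L.Term V × L.Term V) : Finset V := vars e.1 ∪ vars e.2

/-- `s ⊵ t`: `s` encompasses `t`, that is, `s = C[tσ]` for some context `C` and substitution `σ`
(some subterm of `s` is an instance of `t`). Substitutions are maps from variables to terms; since
a term has only finitely many variables, it is immaterial here and below whether their
domains are required to be finite. -/
def Encompasses (s t : L.Term V) : Prop :=
  ∃ (p : List ℕ) (σ : V → L.Term V), subtermAt s p = some (t.subst σ)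

/-- Proper encompassment. -/
def ProperlyEncompasses (s t : L.Term V) : Prop := Encompasses s t ∧ ¬ Encompasses t s

/-- A rewrite step from `s` to `t` at position `p` that uses the pair `(ℓ, r)`. -/
def StepWith (e : L.Term V × L.Term V) (p : List ℕ) (s t : L.Term V) : Prop :=
  ∃ σ : V → L.Term V, subtermAt s p = some (e.1.subst σ) ∧ t = replaceAt s p (e.2.subst σ)

/-- The rewrite relation induced by a set of pairs of terms: its closure under contexts and
substitutions. -/
def Rewrites (P : PairSet L V) (s t : L.Term V) : Prop :=
  ∃ e ∈ P, ∃ p : List ℕ, StepWith e p s t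

/-- A rewrite step from `s` using some rule `ℓ → r` such that `s` properly encompasses `ℓ`. -/
def RewritesProperly (P : PairSet L V) (s t : L.Term V) : Prop :=
  ∃ e ∈ P, ProperlyEncompasses s e.1 ∧ ∃ p : List ℕ, StepWith e p s t

/-- Normal forms of the rewrite relation. -/
def IsNormalForm (P : PairSet L V) (s : L.Term V) : Prop := ∀ t, ¬ Rewrites P s t

/-- Joinability: `s →* · *← t`. -/
def Joinable (P : PairSet L V) (s t : L.Term V) : Prop :=
  Join (ReflTransGen (Rewrites P)) s t

/-- Conversion: the reflexive, symmetric, transitive closure of the rewrite relation. -/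
def Conversion (P : PairSet L V) (s t : L.Term V) : Prop := EqvGen (Rewrites P) s t

/-- The rewrite relation is well-founded: there is no infinite rewrite sequence. -/
def IsTerminating (P : PairSet L V) : Prop := WellFounded (fun t s => Rewrites P s t)

def IsConfluent (P : PairSet L V) : Prop :=
  ∀ s t u, ReflTransGen (Rewrites P) s t → ReflTransGen (Rewrites P) s u → Joinable P t u

/-- The variable condition on rules: no left-hand side is a variable, and every variable of a
right-hand side occurs in the left-hand side. -/
def IsTRS (P : PairSet L V) : Prop := ∀ e ∈ P, ¬ IsVar e.1 ∧ vars e.2 ⊆ vars e.1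

/-- `R` is a complete presentation of `E`: a terminating and confluent term rewrite system with
the same conversion relation as `E`. -/
structure IsCompletePresentation (R E : PairSet L V) : Prop where
  isTRS : IsTRS R
  terminating : IsTerminating R
  confluent : IsConfluent R
  conversion_iff : ∀ s t, Conversion R s t ↔ Conversion E s t

/-- `gt s t` stands for `s > t`. A reduction order is a well-founded order on terms that is closed
under contexts and substitutions. (Irreflexivity follows from well-foundedness.) -/
structure IsReductionOrder (gt : L.Term V → L.Term V → Prop) : Prop where
  trans : ∀ s t u, gt s t → gt t u → gt s u
  wf : WellFounded (fun t s => gt s t)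
  closed_context : ∀ (c : L.Term V) (p : List ℕ) (s t : L.Term V),
    p ∈ positions c → gt s t → gt (replaceAt c p s) (replaceAt c p t)
  closed_subst : ∀ (s t : L.Term V) (σ : V → L.Term V), gt s t → gt (s.subst σ) (t.subst σ)

end Terms

section CriticalPairs

variable {L : FirstOrder.Language.{u, v}} {V : Type w}

/-- Two rules are variants of each other: one is obtained from the other by a renaming, that is,
by a bijective variable substitution. -/
def AreVariants (e e' : L.Term V × L.Term V) : Prop :=
  ∃ π : Equiv.Perm V, e'.1 = e.1.relabel π ∧ e'.2 = e.2.relabel π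

def IsUnifier (σ : V → L.Term V) (s t : L.Term V) : Prop := s.subst σ = t.subst σ

/-- `σ` is a most general unifier of `s` and `t`: every unifier factors through it. -/
def IsMGU (σ : V → L.Term V) (s t : L.Term V) : Prop :=
  IsUnifier σ s t ∧ ∀ τ, IsUnifier τ s t → ∃ δ : V → L.Term V, ∀ x, τ x = (σ x).subst δ

/-- Overlaps `⟨ℓ₁ → r₁, p, ℓ₂ → r₂⟩` of a set of rules. -/
structure IsOverlap (R : PairSet L V) (e₁ : L.Term V × L.Term V) (p : List ℕ)
    (e₂ : L.Term V × L.Term V) : Prop where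
  variant₁ : ∃ e ∈ R, AreVariants e₁ e
  variant₂ : ∃ e ∈ R, AreVariants e₂ e
  disjoint_vars : Disjoint (pairVars e₁) (pairVars e₂)
  mem_funPositions : p ∈ funPositions e₂.1
  unifiable : ∃ u, subtermAt e₂.1 p = some u ∧ ∃ σ, IsUnifier σ e₁.1 u
  not_variants : p = [] → ¬ AreVariants e₁ e₂

/-- The critical peak `t ←[p] s →[ε] u`: here `s = ℓ₂σ`, `t = ℓ₂σ[r₁σ]_p` and `u = r₂σ`, where `σ`
is a most general unifier of `ℓ₁` and `ℓ₂|_p` for an overlap `⟨ℓ₁ → r₁, p, ℓ₂ → r₂⟩`. -/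
def IsCriticalPeak (R : PairSet L V) (t : L.Term V) (p : List ℕ) (s u : L.Term V) : Prop :=
  ∃ (e₁ e₂ : L.Term V × L.Term V) (σ : V → L.Term V) (v : L.Term V),
    IsOverlap R e₁ p e₂ ∧ subtermAt e₂.1 p = some v ∧ IsMGU σ e₁.1 v ∧
    t = replaceAt (e₂.1.subst σ) p (e₁.2.subst σ) ∧ s = e₂.1.subst σ ∧ u = e₂.2.subst σ

/-- A critical peak is prime if all proper subterms of `s|_p` are normal forms. -/
def IsPrimeCriticalPeak (R : PairSet L V) (t : L.Term V) (p : List ℕ) (s u : L.Term V) : Prop :=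
  IsCriticalPeak R t p s u ∧
    ∀ (q : List ℕ) (w : L.Term V), q ≠ [] → subtermAt s (p ++ q) = some w → IsNormalForm R w

/-- The set of prime critical pairs. -/
def PCP (R : PairSet L V) : PairSet L V :=
  {e | ∃ (p : List ℕ) (s : L.Term V), IsPrimeCriticalPeak R e.1 p s e.2}

end CriticalPairs

section Completion

variable {L : FirstOrder.Language.{u, v}} {V : Type w}

/-- The inference steps `(E, R) ⊢ (E', R')` of Knuth-Bendix completion with the encompassment
condition on collapse steps. A disjoint union `X ⊎ {e}` in a premise is expressed by membership of
`e`, its remaining part `X` being the set difference. -/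
inductive KBStep (gt : L.Term V → L.Term V → Prop) :
    PairSet L V × PairSet L V → PairSet L V × PairSet L V → Prop
  | deduce (E R : PairSet L V) (s t c : L.Term V) :
      Rewrites R c s → Rewrites R c t → KBStep gt (E, R) (E ∪ {(s, t)}, R)
  | orient_left (E R : PairSet L V) (s t : L.Term V) :
      (s, t) ∈ E → gt s t → KBStep gt (E, R) (E \ {(s, t)}, R ∪ {(s, t)})
  | orient_right (E R : PairSet L V) (s t : L.Term V) :
      (s, t) ∈ E → gt t s → KBStep gt (E, R) (E \ {(s, t)}, R ∪ {(t, s)})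
  | delete (E R : PairSet L V) (s : L.Term V) :
      (s, s) ∈ E → KBStep gt (E, R) (E \ {(s, s)}, R)
  | compose (E R : PairSet L V) (s t u : L.Term V) :
      (s, t) ∈ R → Rewrites (R \ {(s, t)}) t u →
        KBStep gt (E, R) (E, (R \ {(s, t)}) ∪ {(s, u)})
  | simplify_left (E R : PairSet L V) (s t u : L.Term V) :
      (s, t) ∈ E → Rewrites R s u → KBStep gt (E, R) ((E \ {(s, t)}) ∪ {(u, t)}, R)
  | simplify_right (E R : PairSet L V) (s t u : L.Term V) :
      (s, t) ∈ E → Rewrites R t u → KBStep gt (E, R) ((E \ {(s, t)}) ∪ {(s, u)}, R)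
  | collapse (E R : PairSet L V) (t s u : L.Term V) :
      (t, s) ∈ R → RewritesProperly (R \ {(t, s)}) t u →
        KBStep gt (E, R) (E ∪ {(u, s)}, R \ {(t, s)})

/-- A run `(E₀, R₀) ⊢ (E₁, R₁) ⊢ ⋯` of length `N`: a maximal sequence of inference steps that
starts without rules. It does not terminate if `N = ⊤`; if `N` is finite, no inference step applies
to its last member `(E_N, R_N)`, and the values of `E` and `R` beyond `N` are irrelevant. -/
structure IsRun (gt : L.Term V → L.Term V → Prop) (N : ℕ∞) (E R : ℕ → PairSet L V) : Prop where
  init : R 0 = ∅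
  step : ∀ i : ℕ, (i : ℕ∞) < N → KBStep gt (E i, R i) (E (i + 1), R (i + 1))
  maximal : ∀ n : ℕ, N = n → ∀ S, ¬ KBStep gt (E n, R n) S

/-- The set of all pairs that occur in a run of length `N`: `X_∞ = ⋃ i, X i`. -/
def allPairs (N : ℕ∞) (X : ℕ → PairSet L V) : PairSet L V :=
  {e | ∃ i : ℕ, (i : ℕ∞) ≤ N ∧ e ∈ X i}

/-- The set of persistent pairs of a run of length `N`: `X_ω = ⋃ i, ⋂ j ≥ i, X j`. -/
def persistentPairs (N : ℕ∞) (X : ℕ → PairSet L V) : PairSet L V :=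
  {e | ∃ i : ℕ, (i : ℕ∞) ≤ N ∧ ∀ j : ℕ, i ≤ j → (j : ℕ∞) ≤ N → e ∈ X j}

/-- Fairness: there are no persistent equations, and every prime critical pair of the persistent
rules is joinable by persistent rules or related by one step, in either direction, of the equations
that occur in the run. -/
structure IsFair (N : ℕ∞) (E R : ℕ → PairSet L V) : Prop where
  no_persistent_equation : persistentPairs N E = ∅
  prime_critical_pairs : ∀ s t, (s, t) ∈ PCP (persistentPairs N R) →
    Joinable (persistentPairs N R) s t ∨ SymmGen (Rewrites (allPairs N E)) s t

end Completion

end TermRewriting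

/-!
A reduction order `gt` orients every rule of a run, so the persistent rules terminate, have no
variable as a left-hand side and satisfy the variable condition (a term `s` cannot be greater than
a term that contains `s`). The other two properties rest on conversions whose terms are all bounded
in `gt`.

*Simulation.* A step between `s` and `t` with any equation or rule of the run is simulated by a
conversion with persistent rules through terms that are at most `s` or at most `t`
(`IsRun.conversionIn_of_stepWith`). This is proof reduction: a pair that does not persist is removed
by some inference step, which replaces the given step by cheaper ones. The cost is compared
lexicographically by a multiset of terms, then by encompassment of the left-hand sides (which is
what justifies collapse steps), then by the right-hand term. Properness of encompassment is
measured by the size and the number of variables of a term. Together with the soundness of the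
inference steps, simulation shows that conversion is preserved.

*Confluence.* It suffices that the two sides of every peak of persistent rules are connected by a
conversion through terms smaller than the source of the peak
(`isConfluent_of_conversionIn_peak`). The peaks of interest have one step at the root and one, the
inner step, at a position `p`. If the redex at `p` has only normal forms as proper subterms, then
the peak is joinable (a variable overlap), trivial (a root overlap of variants), or
an instance of a prime critical peak (`eq_or_exists_prime_critical_peak`, which needs renaming apart
and most general unifiers). For the latter, fairness gives joinability or an equation of the run,
and simulation bounds the terms. If the redex at `p` contains a smaller redex, then a step at
an innermost redex below `p` splits the peak into two peaks of the former kind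
(`conversionIn_of_root_peak`).
-/

namespace TermRewriting

open FirstOrder Relation

variable {L : FirstOrder.Language.{u, v}} {V : Type w}

/-! ### Terms, positions and substitutions -/

@[simp] theorem subtermAt_nil (t : L.Term V) : subtermAt t [] = some t := by
  cases t <;> simp [subtermAt]

@[simp] theorem subtermAt_var_cons (x : V) (i : ℕ) (p : List ℕ) :
    subtermAt (.var x : L.Term V) (i :: p) = none := by
  simp [subtermAt]

theorem subtermAt_func_cons {n : ℕ} (f : L.Functions n) (ts : Fin n → L.Term V) (i : Fin n)
    (p : List ℕ) : subtermAt (.func f ts) (i.1 :: p) = subtermAt (ts i) p := by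
  simp [subtermAt]

@[simp] theorem replaceAt_nil (t u : L.Term V) : replaceAt t [] u = u := by
  cases t <;> simp [replaceAt]

theorem replaceAt_func_cons {n : ℕ} (f : L.Functions n) (ts : Fin n → L.Term V) (i : Fin n)
    (p : List ℕ) (u : L.Term V) :
    replaceAt (.func f ts) (i.1 :: p) u =
      .func f (Function.update ts i (replaceAt (ts i) p u)) := by
  simp [replaceAt]

theorem exists_func_of_subtermAt_cons {t u : L.Term V} {i : ℕ} {p : List ℕ}
    (h : subtermAt t (i :: p) = some u) :
    ∃ (n : ℕ) (f : L.Functions n) (ts : Fin n → L.Term V) (j : Fin n),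
      t = .func f ts ∧ i = j.1 ∧ subtermAt (ts j) p = some u := by
  cases t with
  | var x => simp at h
  | @func n f ts =>
    by_cases hi : i < n
    · exact ⟨n, f, ts, ⟨i, hi⟩, rfl, rfl, by simpa [subtermAt, hi] using h⟩
    · simp [subtermAt, hi] at h

theorem subtermAt_append {t u : L.Term V} {p : List ℕ} (q : List ℕ)
    (h : subtermAt t p = some u) : subtermAt t (p ++ q) = subtermAt u q := by
  induction p generalizing t with
  | nil => simp_all
  | cons i p ih =>
    obtain ⟨n, f, ts, j, rfl, rfl, h'⟩ := exists_func_of_subtermAt_cons h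
    rw [List.cons_append, subtermAt_func_cons, ih h']

theorem replaceAt_append {t u : L.Term V} {p : List ℕ} (q : List ℕ) (v : L.Term V)
    (h : subtermAt t p = some u) :
    replaceAt t (p ++ q) v = replaceAt t p (replaceAt u q v) := by
  induction p generalizing t with
  | nil => simp_all
  | cons i p ih =>
    obtain ⟨n, f, ts, j, rfl, rfl, h'⟩ := exists_func_of_subtermAt_cons h
    rw [List.cons_append, replaceAt_func_cons, replaceAt_func_cons, ih h']

theorem subtermAt_replaceAt_self {t u : L.Term V} {p : List ℕ} (v : L.Term V)
    (h : subtermAt t p = some u) : subtermAt (replaceAt t p v) p = some v := by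
  induction p generalizing t with
  | nil => simp
  | cons i p ih =>
    obtain ⟨n, f, ts, j, rfl, rfl, h'⟩ := exists_func_of_subtermAt_cons h
    rw [replaceAt_func_cons, subtermAt_func_cons, Function.update_self, ih h']

theorem replaceAt_replaceAt_self {t u : L.Term V} {p : List ℕ} (v w : L.Term V)
    (h : subtermAt t p = some u) : replaceAt (replaceAt t p v) p w = replaceAt t p w := by
  induction p generalizing t with
  | nil => simp
  | cons i p ih =>
    obtain ⟨n, f, ts, j, rfl, rfl, h'⟩ := exists_func_of_subtermAt_cons h
    rw [replaceAt_func_cons, replaceAt_func_cons, replaceAt_func_cons, Function.update_self,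
      ih h', Function.update_idem]

theorem replaceAt_subtermAt_self {t u : L.Term V} {p : List ℕ}
    (h : subtermAt t p = some u) : replaceAt t p u = t := by
  induction p generalizing t with
  | nil => simp_all
  | cons i p ih =>
    obtain ⟨n, f, ts, j, rfl, rfl, h'⟩ := exists_func_of_subtermAt_cons h
    rw [replaceAt_func_cons, ih h', Function.update_eq_self]

theorem subtermAt_subst {t u : L.Term V} {p : List ℕ} (σ : V → L.Term V)
    (h : subtermAt t p = some u) : subtermAt (t.subst σ) p = some (u.subst σ) := by
  induction p generalizing t with
  | nil => simp_all
  | cons i p ih =>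
    obtain ⟨n, f, ts, j, rfl, rfl, h'⟩ := exists_func_of_subtermAt_cons h
    rw [Language.Term.subst, subtermAt_func_cons, ih h']

theorem replaceAt_subst {t u : L.Term V} {p : List ℕ} (v : L.Term V) (σ : V → L.Term V)
    (h : subtermAt t p = some u) :
    (replaceAt t p v).subst σ = replaceAt (t.subst σ) p (v.subst σ) := by
  induction p generalizing t with
  | nil => simp
  | cons i p ih =>
    obtain ⟨n, f, ts, j, rfl, rfl, h'⟩ := exists_func_of_subtermAt_cons h
    rw [replaceAt_func_cons, Language.Term.subst, Language.Term.subst, replaceAt_func_cons,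
      ← ih h']
    congr 1
    funext k
    by_cases hk : k = j
    · subst hk; simp
    · simp [hk]

theorem subst_subst (t : L.Term V) (σ τ : V → L.Term V) :
    (t.subst σ).subst τ = t.subst fun x => (σ x).subst τ := by
  induction t with
  | var x => rfl
  | func f ts ih => simp [Language.Term.subst, ih]

theorem subst_var (t : L.Term V) : t.subst Language.Term.var = t := by
  induction t with
  | var x => rfl
  | func f ts ih => simp [Language.Term.subst, ih]

theorem subst_relabel (t : L.Term V) (g : V → V) (σ : V → L.Term V) :
    (t.relabel g).subst σ = t.subst (σ ∘ g) := by
  induction t with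
  | var x => rfl
  | func f ts ih => simp [Language.Term.subst, ih]

@[simp] theorem mem_vars_var {x y : V} : x ∈ vars (.var y : L.Term V) ↔ x = y := by
  simp [vars]

@[simp] theorem mem_vars_func {n : ℕ} {f : L.Functions n} {ts : Fin n → L.Term V} {x : V} :
    x ∈ vars (.func f ts) ↔ ∃ i, x ∈ vars (ts i) := by
  simp [vars]

theorem subst_congr {t : L.Term V} {σ τ : V → L.Term V} (h : ∀ x ∈ vars t, σ x = τ x) :
    t.subst σ = t.subst τ := by
  induction t with
  | var x => exact h x (by simp)
  | func f ts ih =>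
    simp only [Language.Term.subst]
    congr 1
    funext i
    exact ih i fun x hx => h x (mem_vars_func.2 ⟨i, hx⟩)

theorem eqOn_vars_of_subst_eq {t : L.Term V} {σ τ : V → L.Term V} (h : t.subst σ = t.subst τ) :
    ∀ x ∈ vars t, σ x = τ x := by
  induction t with
  | var x => intro y hy; rw [mem_vars_var.1 hy]; exact h
  | func f ts ih =>
    simp only [Language.Term.subst, Language.Term.func.injEq, heq_eq_eq, true_and] at h
    intro x hx
    obtain ⟨i, hi⟩ := mem_vars_func.1 hx
    exact ih i (congrFun h i) x hi

theorem mem_vars_relabel {t : L.Term V} {g : V → V} {x : V} :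
    x ∈ vars (t.relabel g) ↔ ∃ y ∈ vars t, g y = x := by
  induction t with
  | var y => simp [eq_comm]
  | func f ts ih =>
    simp only [Language.Term.relabel, mem_vars_func, ih]
    tauto

theorem mem_vars_subst {t : L.Term V} {σ : V → L.Term V} {x : V} :
    x ∈ vars (t.subst σ) ↔ ∃ y ∈ vars t, x ∈ vars (σ y) := by
  induction t with
  | var y => simp [Language.Term.subst]
  | func f ts ih =>
    simp only [Language.Term.subst, mem_vars_func, ih]
    tauto

theorem exists_subtermAt_of_mem_vars {t : L.Term V} {x : V} (h : x ∈ vars t) :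
    ∃ p, subtermAt t p = some (.var x) := by
  induction t with
  | var y => exact ⟨[], by simp [mem_vars_var.1 h]⟩
  | func f ts ih =>
    obtain ⟨i, hi⟩ := mem_vars_func.1 h
    obtain ⟨p, hp⟩ := ih i hi
    exact ⟨i.1 :: p, by rw [subtermAt_func_cons, hp]⟩

/-- Any position of an instance `tσ` is a function symbol position of `t`, or it lies at or below
the position of a variable of `t`. -/
theorem mem_funPositions_or_of_subtermAt_subst {t w : L.Term V} {σ : V → L.Term V} {p : List ℕ}
    (h : subtermAt (t.subst σ) p = some w) :
    (∃ u, subtermAt t p = some u ∧ ¬ IsVar u) ∨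
      ∃ p₁ p₂ x, p = p₁ ++ p₂ ∧ subtermAt t p₁ = some (.var x) ∧ subtermAt (σ x) p₂ = some w := by
  induction p generalizing t with
  | nil =>
    by_cases hv : IsVar t
    · obtain ⟨x, rfl⟩ := hv
      exact .inr ⟨[], [], x, rfl, by simp, h⟩
    · exact .inl ⟨t, by simp, hv⟩
  | cons i p ih =>
    cases t with
    | var x => exact .inr ⟨[], i :: p, x, rfl, by simp, h⟩
    | func f ts =>
      rw [Language.Term.subst] at h
      obtain ⟨n, g, us, j, hg, rfl, h'⟩ := exists_func_of_subtermAt_cons h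
      cases hg
      rcases ih h' with ⟨u, hu, hv⟩ | ⟨p₁, p₂, x, rfl, h₁, h₂⟩
      · exact .inl ⟨u, by rwa [subtermAt_func_cons], hv⟩
      · exact .inr ⟨j.1 :: p₁, p₂, x, rfl, by rwa [subtermAt_func_cons], h₂⟩

/-- The size of a term, each occurrence of a variable counting once and each occurrence of a
function symbol twice. Hence the terms of size one are exactly the variables. -/
def size : L.Term V → ℕ
  | .var _ => 1
  | .func _ ts => 2 + ∑ i, size (ts i)

theorem size_pos (t : L.Term V) : 0 < size t := by
  cases t <;> rw [size] <;> omega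

theorem size_lt_size_func {n : ℕ} (f : L.Functions n) (ts : Fin n → L.Term V) (i : Fin n) :
    size (ts i) < size (.func f ts) := by
  rw [size]
  have := Finset.single_le_sum (f := fun i => size (ts i)) (fun _ _ => Nat.zero_le _)
    (Finset.mem_univ i)
  have : size (ts i) ≤ ∑ i, size (ts i) := this
  omega

theorem size_lt_of_subtermAt {t u : L.Term V} {p : List ℕ} (h : subtermAt t p = some u)
    (hp : p ≠ []) : size u < size t := by
  induction p generalizing t with
  | nil => exact absurd rfl hp
  | cons i p ih =>
    obtain ⟨n, f, ts, j, rfl, rfl, h'⟩ := exists_func_of_subtermAt_cons h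
    refine lt_of_le_of_lt ?_ (size_lt_size_func f ts j)
    by_cases hp' : p = []
    · subst hp'; simp_all
    · exact (ih h' hp').le

theorem size_le_of_subtermAt {t u : L.Term V} {p : List ℕ} (h : subtermAt t p = some u) :
    size u ≤ size t := by
  by_cases hp : p = []
  · subst hp; simp_all
  · exact (size_lt_of_subtermAt h hp).le

theorem size_le_size_subst (t : L.Term V) (σ : V → L.Term V) : size t ≤ size (t.subst σ) := by
  induction t with
  | var x => exact size_pos _
  | func f ts ih =>
    simp only [Language.Term.subst, size]
    gcongr with i
    exact ih i

/-- A substitution that does not increase the size of a term maps its variables to variables. -/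
theorem isVar_of_size_subst_le {t : L.Term V} {σ : V → L.Term V}
    (h : size (t.subst σ) ≤ size t) : ∀ x ∈ vars t, IsVar (σ x) := by
  induction t with
  | var x =>
    intro y hy
    rw [mem_vars_var.1 hy]
    change size (σ x) ≤ 1 at h
    cases hx : σ x with
    | var z => exact ⟨z, rfl⟩
    | func f ts => rw [hx, size] at h; omega
  | func f ts ih =>
    intro x hx
    obtain ⟨i, hi⟩ := mem_vars_func.1 hx
    refine ih i ?_ x hi
    simp only [Language.Term.subst, size] at h
    by_contra hlt
    have := Finset.sum_lt_sum (s := Finset.univ) (fun j _ => size_le_size_subst (ts j) σ)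
      ⟨i, Finset.mem_univ i, not_le.1 hlt⟩
    omega

/-- The number of variables of a term is at most its size. -/
theorem card_vars_le_size (t : L.Term V) : (vars t).card ≤ size t := by
  classical
  induction t with
  | var x => simp [vars, size]
  | func f ts ih =>
    have h : vars (.func f ts) = Finset.univ.biUnion fun i => vars (ts i) := by
      ext x; simp
    rw [h, size]
    have := Finset.card_biUnion_le (s := Finset.univ) (t := fun i => vars (ts i))
    have := Finset.sum_le_sum (s := Finset.univ) fun i _ => ih i
    omega

/-- Proper encompassment decreases the size, or else it keeps the size and increases the
number of variables; so it is well-founded. -/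
theorem ProperlyEncompasses.size_lt_or {s t : L.Term V} (h : ProperlyEncompasses s t) :
    size t < size s ∨ size t = size s ∧ size t - (vars t).card < size s - (vars s).card := by
  classical
  obtain ⟨⟨p, σ, hp⟩, hn⟩ := h
  have h₁ := size_le_of_subtermAt hp
  have h₂ := size_le_size_subst t σ
  by_cases hlt : size t < size s
  · exact .inl hlt
  have hp0 : p = [] := by
    by_contra hp0
    have := size_lt_of_subtermAt hp hp0
    omega
  subst hp0
  simp only [subtermAt_nil, Option.some.injEq] at hp
  subst hp
  have heq : size t = size (t.subst σ) := by omega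
  refine .inr ⟨heq, ?_⟩
  have hv := isVar_of_size_subst_le heq.ge
  choose! g hg using hv
  have himg : vars (t.subst σ) = (vars t).image g := by
    ext x
    rw [mem_vars_subst, Finset.mem_image]
    exact exists_congr fun y => and_congr_right fun hy => by
      rw [hg y hy, mem_vars_var, eq_comm]
  have hcard : (vars (t.subst σ)).card < (vars t).card := by
    rw [himg]
    refine lt_of_le_of_ne Finset.card_image_le fun hc => hn ?_
    -- if `σ` is injective on the variables of `t`, its inverse gives `t` back
    have hinj := Finset.card_image_iff.1 hc
    cases isEmpty_or_nonempty V with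
    | inl hV =>
      refine ⟨[], Language.Term.var, ?_⟩
      rw [subtermAt_nil, subst_subst, subst_congr (τ := Language.Term.var), subst_var]
      exact fun x => isEmptyElim x
    | inr hV =>
      refine ⟨[], fun y => .var (Function.invFunOn g (vars t) y), ?_⟩
      rw [subtermAt_nil, subst_subst, subst_congr (τ := Language.Term.var), subst_var]
      intro x hx
      rw [hg x hx]
      exact congrArg _ (hinj.leftInvOn_invFunOn hx)
  have := card_vars_le_size t
  omega

/-! ### Unification and renaming apart -/

theorem size_subst_lt_of_mem_vars {t : L.Term V} {σ : V → L.Term V} {x : V} (hx : x ∈ vars t)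
    (ht : t ≠ .var x) : size (σ x) < size (t.subst σ) := by
  obtain ⟨p, hp⟩ := exists_subtermAt_of_mem_vars hx
  refine size_lt_of_subtermAt (p := p) (subtermAt_subst σ hp) ?_
  rintro rfl
  simp_all

/-- A simultaneous unifier of a list of pairs of terms. -/
def UnifiesAll (σ : V → L.Term V) (l : List (L.Term V × L.Term V)) : Prop :=
  ∀ e ∈ l, IsUnifier σ e.1 e.2

/-- `σ` is an idempotent most general unifier of a list of pairs of terms: every unifier `τ`
satisfies `τ = τ ∘ σ`. -/
def IsIdempotentMGU (σ : V → L.Term V) (l : List (L.Term V × L.Term V)) : Prop :=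
  UnifiesAll σ l ∧ ∀ τ, UnifiesAll τ l → ∀ x, τ x = (σ x).subst τ

theorem IsIdempotentMGU.congr {l l' : List (L.Term V × L.Term V)} {σ : V → L.Term V}
    (h : ∀ τ, UnifiesAll τ l ↔ UnifiesAll τ l') (hσ : IsIdempotentMGU σ l) :
    IsIdempotentMGU σ l' :=
  ⟨(h σ).1 hσ.1, fun τ hτ => hσ.2 τ ((h τ).2 hτ)⟩

theorem unifiesAll_cons {τ : V → L.Term V} {e : L.Term V × L.Term V}
    {l : List (L.Term V × L.Term V)} :
    UnifiesAll τ (e :: l) ↔ IsUnifier τ e.1 e.2 ∧ UnifiesAll τ l := by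
  simp [UnifiesAll]

theorem isUnifier_comm {τ : V → L.Term V} {s t : L.Term V} :
    IsUnifier τ s t ↔ IsUnifier τ t s := eq_comm

theorem unifiesAll_func_cons {n : ℕ} {f : L.Functions n} {ss ts : Fin n → L.Term V}
    {l : List (L.Term V × L.Term V)} {τ : V → L.Term V} :
    UnifiesAll τ ((List.ofFn fun i => (ss i, ts i)) ++ l) ↔
      UnifiesAll τ ((.func f ss, .func f ts) :: l) := by
  rw [unifiesAll_cons]
  simp only [UnifiesAll, List.mem_append, or_imp, forall_and, List.mem_ofFn, 
    forall_exists_index, forall_apply_eq_imp_iff, IsUnifier, Language.Term.subst,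
    Language.Term.func.injEq, heq_eq_eq, true_and, funext_iff]

open scoped Classical in
/-- Elimination of a variable `x` by an equation `x ≈ t` with `x` not in `t`. -/
theorem IsIdempotentMGU.cons_var {l : List (L.Term V × L.Term V)} {σ : V → L.Term V} {x : V}
    {t : L.Term V} (hx : x ∉ vars t)
    (hσ : IsIdempotentMGU σ (l.map fun e =>
      (e.1.subst (Function.update Language.Term.var x t),
        e.2.subst (Function.update Language.Term.var x t)))) :
    IsIdempotentMGU (fun y => (Function.update Language.Term.var x t y).subst σ)
      ((.var x, t) :: l) := by
  set ρ : V → L.Term V := Function.update Language.Term.var x t with hρ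
  have htρ : t.subst ρ = t := by
    rw [subst_congr (τ := Language.Term.var), subst_var]
    intro y hy
    rw [hρ, Function.update_of_ne]
    rintro rfl
    exact hx hy
  refine ⟨unifiesAll_cons.2 ⟨?_, fun e he => ?_⟩, fun τ hτ y => ?_⟩
  · change (ρ x).subst σ = t.subst fun y => (ρ y).subst σ
    rw [← subst_subst, htρ, hρ, Function.update_self]
  · have := hσ.1 _ (List.mem_map_of_mem he)
    simpa only [IsUnifier, subst_subst] using this
  · rw [unifiesAll_cons] at hτ
    have hτρ : ∀ z, (ρ z).subst τ = τ z := by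
      intro z
      by_cases hz : z = x
      · subst hz; rw [hρ, Function.update_self]; exact hτ.1.symm
      · rw [hρ, Function.update_of_ne hz]; rfl
    have hτ' : ∀ z, τ z = (σ z).subst τ := by
      refine hσ.2 τ fun e he => ?_
      obtain ⟨e', he', rfl⟩ := List.mem_map.1 he
      simp only [IsUnifier, subst_subst, hτρ]
      exact hτ.2 e' he'
    simp only [subst_subst]
    rw [← subst_congr fun z _ => hτ' z, hτρ]

/-- Robinson's theorem. The induction is on the total size of the left components after
application of a given unifier `τ`; this size does not change when a variable is eliminated in
the remaining pairs, as `τ` absorbs the eliminating substitution. -/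
theorem exists_isIdempotentMGU (τ : V → L.Term V) (l : List (L.Term V × L.Term V))
    (hτ : UnifiesAll τ l) : ∃ σ, IsIdempotentMGU σ l := by
  classical
  induction hn : (l.map fun e => size (e.1.subst τ)).sum using Nat.strong_induction_on
    generalizing l with
  | _ n ih =>
  subst hn
  match l, hτ with
  | [], _ => exact ⟨Language.Term.var, by simp [UnifiesAll], fun τ _ x => rfl⟩
  | (s, t) :: l, hτ =>
    have hcons := unifiesAll_cons.1 hτ
    have hpos := size_pos (s.subst τ)
    by_cases hst : s = t
    · subst hst
      obtain ⟨σ, hσ⟩ := ih _ (by simp only [List.map_cons, List.sum_cons]; omega) l hcons.2 rfl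
      exact ⟨σ, hσ.congr fun τ => by simp [unifiesAll_cons, IsUnifier]⟩
    have elim : ∀ (x : V) (u : L.Term V), Language.Term.var x ≠ u → IsUnifier τ (.var x) u →
        ∃ σ, IsIdempotentMGU σ ((.var x, u) :: l) := by
      intro x u hne hu
      have hx : x ∉ vars u := by
        intro hx
        have := size_subst_lt_of_mem_vars (σ := τ) hx hne.symm
        rw [← hu] at this
        exact lt_irrefl _ this
      have habs : ∀ w : L.Term V,
          (w.subst (Function.update Language.Term.var x u)).subst τ = w.subst τ := by
        intro w
        rw [subst_subst]
        refine subst_congr fun z _ => ?_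
        by_cases hz : z = x
        · subst hz; rw [Function.update_self]; exact hu.symm
        · rw [Function.update_of_ne hz]; rfl
      have hdec : ((l.map fun e => (e.1.subst (Function.update Language.Term.var x u),
          e.2.subst (Function.update Language.Term.var x u))).map
            fun e => size (e.1.subst τ)).sum < (((s, t) :: l).map
              fun e => size (e.1.subst τ)).sum := by
        simp only [List.map_cons, List.sum_cons, List.map_map, Function.comp_def, habs]
        omega
      obtain ⟨σ, hσ⟩ := ih _ hdec _ (fun e he => by
        obtain ⟨e', he', rfl⟩ := List.mem_map.1 he
        simpa only [IsUnifier, habs] using hcons.2 e' he') rfl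
      exact ⟨_, hσ.cons_var hx⟩
    cases s with
    | var x => exact elim x t hst hcons.1
    | func f ss =>
      cases t with
      | var x =>
        obtain ⟨σ, hσ⟩ := elim x _ (Ne.symm hst) hcons.1.symm
        exact ⟨σ, hσ.congr fun τ => by
          simp only [unifiesAll_cons]; rw [isUnifier_comm]⟩
      | func g ts =>
        have h := hcons.1
        simp only [IsUnifier, Language.Term.subst] at h
        injection h with h₁ h₂ h₃
        subst h₁
        cases h₂
        have hdec : (((List.ofFn fun i => (ss i, ts i)) ++ l).map
            fun e => size (e.1.subst τ)).sum <
              (((Language.Term.func f ss, Language.Term.func f ts) :: l).map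
                fun e => size (e.1.subst τ)).sum := by
          simp only [List.map_append, List.map_ofFn, List.sum_append, List.sum_ofFn,
            Function.comp_def, List.map_cons, List.sum_cons, Language.Term.subst, size]
          omega
        obtain ⟨σ, hσ⟩ := ih _ hdec _ (unifiesAll_func_cons.2 hτ) rfl
        exact ⟨σ, hσ.congr fun τ => unifiesAll_func_cons⟩

theorem exists_isMGU {s t : L.Term V} {τ : V → L.Term V} (h : IsUnifier τ s t) :
    ∃ σ, IsMGU σ s t := by
  obtain ⟨σ, h₁, h₂⟩ := exists_isIdempotentMGU τ [(s, t)] (by simpa [UnifiesAll] using h)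
  exact ⟨σ, by simpa [UnifiesAll] using h₁,
    fun τ' hτ' => ⟨τ', h₂ τ' (by simpa [UnifiesAll] using hτ')⟩⟩

/-- Over infinitely many variables, finitely many of them can be renamed apart. -/
theorem exists_perm_disjoint [Infinite V] [DecidableEq V] (A B : Finset V) :
    ∃ π : Equiv.Perm V, ∀ x ∈ A, π x ∉ B := by
  induction A using Finset.induction_on with
  | empty => exact ⟨1, by simp⟩
  | insert a A ha ih =>
    obtain ⟨π, hπ⟩ := ih
    obtain ⟨c, hc⟩ := Infinite.exists_notMem_finset (insert (π a) (B ∪ A.image π))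
    simp only [Finset.mem_insert, Finset.mem_union, Finset.mem_image, not_or, not_exists,
      not_and] at hc
    refine ⟨Equiv.swap (π a) c * π, fun x hx => ?_⟩
    rw [Equiv.Perm.mul_apply]
    rcases Finset.mem_insert.1 hx with rfl | hx
    · rw [Equiv.swap_apply_left]
      exact hc.2.1
    · rw [Equiv.swap_apply_of_ne_of_ne]
      · exact hπ x hx
      · intro h
        exact ha (π.injective h ▸ hx)
      · exact hc.2.2 x hx

/-! ### Rewriting and conversions inside a set of terms -/

theorem StepWith.context {e : L.Term V × L.Term V} {p q : List ℕ} {s t c u : L.Term V}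
    (h : StepWith e p s t) (hq : subtermAt c q = some u) :
    StepWith e (q ++ p) (replaceAt c q s) (replaceAt c q t) := by
  obtain ⟨σ, h₁, rfl⟩ := h
  have hs := subtermAt_replaceAt_self s hq
  refine ⟨σ, by rw [subtermAt_append p hs, h₁], ?_⟩
  rw [replaceAt_append p _ hs, replaceAt_replaceAt_self _ _ hq]

theorem StepWith.subst {e : L.Term V × L.Term V} {p : List ℕ} {s t : L.Term V}
    (h : StepWith e p s t) (τ : V → L.Term V) : StepWith e p (s.subst τ) (t.subst τ) := by
  obtain ⟨σ, h₁, rfl⟩ := h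
  refine ⟨fun x => (σ x).subst τ, ?_, ?_⟩
  · rw [subtermAt_subst τ h₁, subst_subst]
  · rw [replaceAt_subst _ _ h₁, subst_subst]

theorem StepWith.swap {e : L.Term V × L.Term V} {p : List ℕ} {s t : L.Term V}
    (h : StepWith e p s t) : StepWith e.swap p t s := by
  obtain ⟨σ, h₁, rfl⟩ := h
  refine ⟨σ, subtermAt_replaceAt_self _ h₁, ?_⟩
  rw [replaceAt_replaceAt_self _ _ h₁]
  exact (replaceAt_subtermAt_self h₁).symm

theorem stepWith_self (e : L.Term V × L.Term V) : StepWith e [] e.1 e.2 :=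
  ⟨Language.Term.var, by simp [subst_var], by simp [subst_var]⟩

theorem Rewrites.context {P : PairSet L V} {q : List ℕ} {s t c u : L.Term V}
    (h : Rewrites P s t) (hq : subtermAt c q = some u) :
    Rewrites P (replaceAt c q s) (replaceAt c q t) := by
  obtain ⟨e, he, p, hp⟩ := h
  exact ⟨e, he, _, hp.context hq⟩

theorem Rewrites.subst {P : PairSet L V} {s t : L.Term V} (h : Rewrites P s t)
    (τ : V → L.Term V) : Rewrites P (s.subst τ) (t.subst τ) := by
  obtain ⟨e, he, p, hp⟩ := h
  exact ⟨e, he, p, hp.subst τ⟩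

theorem Rewrites.mono {P Q : PairSet L V} (hPQ : P ⊆ Q) {s t : L.Term V} (h : Rewrites P s t) :
    Rewrites Q s t := by
  obtain ⟨e, he, hp⟩ := h
  exact ⟨e, hPQ he, hp⟩

theorem Rewrites.of_mem {P : PairSet L V} {s t : L.Term V} (h : (s, t) ∈ P) : Rewrites P s t :=
  ⟨_, h, _, stepWith_self _⟩

theorem IsNormalForm.of_subst {P : PairSet L V} {s : L.Term V} {τ : V → L.Term V}
    (h : IsNormalForm P (s.subst τ)) : IsNormalForm P s :=
  fun _ ht => h _ (ht.subst τ)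

theorem Rewrites.func {P : PairSet L V} {n : ℕ} (f : L.Functions n) {ts : Fin n → L.Term V}
    {i : Fin n} {t : L.Term V} (h : Rewrites P (ts i) t) :
    Rewrites P (.func f ts) (.func f (Function.update ts i t)) := by
  have := h.context (c := .func f ts) (q := [i.1]) (u := ts i)
    (by rw [subtermAt_func_cons, subtermAt_nil])
  rwa [replaceAt_func_cons, replaceAt_func_cons, replaceAt_nil, replaceAt_nil,
    Function.update_eq_self] at this

/-- Rewriting arguments of a function symbol one after the other. -/
theorem reflTransGen_rewrites_func {P : PairSet L V} {n : ℕ} (f : L.Functions n)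
    {ss ts : Fin n → L.Term V} (h : ∀ i, ReflTransGen (Rewrites P) (ss i) (ts i)) :
    ReflTransGen (Rewrites P) (.func f ss) (.func f ts) := by
  classical
  have key : ∀ S : Finset (Fin n), ReflTransGen (Rewrites P) (.func f ss)
      (.func f fun i => if i ∈ S then ts i else ss i) := by
    intro S
    induction S using Finset.induction_on with
    | empty => simpa using ReflTransGen.refl
    | insert a S ha ih =>
      refine ih.trans ?_
      set us : Fin n → L.Term V := fun i => if i ∈ S then ts i else ss i with hus
      have hlift := ReflTransGen.lift (p := Rewrites P)
        (fun w => .func f (Function.update us a w)) (fun x y hxy => by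
          simpa using Rewrites.func f (ts := Function.update us a x) (i := a)
            (by rwa [Function.update_self])) _ _ (h a)
      convert hlift using 2
      · simp [hus, ha]
      · funext i
        by_cases hi : i = a
        · subst hi; simp
        · simp [hus, hi]
  simpa using key Finset.univ

theorem reflTransGen_rewrites_subst {P : PairSet L V} {σ τ : V → L.Term V} (t : L.Term V)
    (h : ∀ x, ReflTransGen (Rewrites P) (σ x) (τ x)) :
    ReflTransGen (Rewrites P) (t.subst σ) (t.subst τ) := by
  induction t with
  | var x => exact h x
  | func f ts ih => exact reflTransGen_rewrites_func f ih

/-- If one occurrence of a variable in an instance `tσ` has been rewritten according to `τ`, the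
other variables can follow. -/
theorem reflTransGen_rewrites_replaceAt_subst {P : PairSet L V} {σ τ : V → L.Term V}
    {t : L.Term V} {x : V} {p : List ℕ} (hp : subtermAt t p = some (.var x))
    (h : ∀ x, ReflTransGen (Rewrites P) (σ x) (τ x)) :
    ReflTransGen (Rewrites P) (replaceAt (t.subst σ) p (τ x)) (t.subst τ) := by
  induction p generalizing t with
  | nil =>
    simp only [subtermAt_nil, Option.some.injEq] at hp
    subst hp
    rw [replaceAt_nil]
    exact ReflTransGen.refl
  | cons i p ih =>
    obtain ⟨n, f, ts, j, rfl, rfl, h'⟩ := exists_func_of_subtermAt_cons hp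
    rw [Language.Term.subst, replaceAt_func_cons, Language.Term.subst]
    refine reflTransGen_rewrites_func f fun i => ?_
    by_cases hi : i = j
    · subst hi
      rw [Function.update_self]
      exact ih h'
    · rw [Function.update_of_ne hi]
      exact reflTransGen_rewrites_subst _ h

/-- Conversions all of whose steps relate terms that satisfy `M`. -/
def ConversionIn (M : L.Term V → Prop) (P : PairSet L V) : L.Term V → L.Term V → Prop :=
  ReflTransGen fun a b => SymmGen (Rewrites P) a b ∧ M a ∧ M b

section ConversionIn

variable {M : L.Term V → Prop} {P : PairSet L V} {s t u : L.Term V}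

theorem ConversionIn.refl (M : L.Term V → Prop) (P : PairSet L V) (s : L.Term V) :
    ConversionIn M P s s := ReflTransGen.refl

theorem ConversionIn.symm (h : ConversionIn M P s t) : ConversionIn M P t s :=
  ReflTransGen.mono (fun _ _ hab => ⟨hab.1.symm, hab.2.2, hab.2.1⟩) _ _ (reflTransGen_swap.2 h)

theorem ConversionIn.trans (h₁ : ConversionIn M P s t) (h₂ : ConversionIn M P t u) :
    ConversionIn M P s u := ReflTransGen.trans h₁ h₂

theorem ConversionIn.mono {M' : L.Term V → Prop} (hM : ∀ w, M w → M' w)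
    (h : ConversionIn M P s t) : ConversionIn M' P s t :=
  ReflTransGen.mono (fun _ _ hab => ⟨hab.1, hM _ hab.2.1, hM _ hab.2.2⟩) _ _ h

theorem ConversionIn.single (h : Rewrites P s t) (hs : M s) (ht : M t) : ConversionIn M P s t :=
  ReflTransGen.single ⟨.of_rel h, hs, ht⟩

theorem ConversionIn.lift {M' : L.Term V → Prop} (f : L.Term V → L.Term V)
    (hf : ∀ a b, Rewrites P a b → Rewrites P (f a) (f b)) (hM : ∀ a, M a → M' (f a))
    (h : ConversionIn M P s t) : ConversionIn M' P (f s) (f t) :=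
  ReflTransGen.lift f
    (fun a b hab => ⟨hab.1.imp (hf a b) (hf b a), hM _ hab.2.1, hM _ hab.2.2⟩) _ _ h

theorem ConversionIn.conversion (h : ConversionIn M P s t) : Conversion P s t := by
  induction h with
  | refl => exact EqvGen.refl _
  | tail _ hab ih =>
    refine ih.trans _ _ _ ?_
    rcases hab.1 with hab | hab
    · exact EqvGen.rel _ _ hab
    · exact (EqvGen.rel _ _ hab).symm

theorem ConversionIn.of_reflTransGen (h : ReflTransGen (Rewrites P) s t) (hs : M s)
    (hM : ∀ a b, M a → Rewrites P a b → M b) : M t ∧ ConversionIn M P s t := by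
  induction h with
  | refl => exact ⟨hs, ConversionIn.refl _ _ _⟩
  | tail _ hab ih =>
    have := hM _ _ ih.1 hab
    exact ⟨this, ih.2.trans (ConversionIn.single hab ih.1 this)⟩

end ConversionIn

theorem Conversion.context {P : PairSet L V} {q : List ℕ} {s t c u : L.Term V}
    (h : Conversion P s t) (hq : subtermAt c q = some u) :
    Conversion P (replaceAt c q s) (replaceAt c q t) := by
  induction h with
  | rel a b h => exact EqvGen.rel _ _ (h.context hq)
  | refl a => exact EqvGen.refl _
  | symm a b _ ih => exact ih.symm
  | trans a b c _ _ ih₁ ih₂ => exact ih₁.trans _ _ _ ih₂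

theorem Conversion.subst {P : PairSet L V} {s t : L.Term V} (h : Conversion P s t)
    (τ : V → L.Term V) : Conversion P (s.subst τ) (t.subst τ) := by
  induction h with
  | rel a b h => exact EqvGen.rel _ _ (h.subst τ)
  | refl a => exact EqvGen.refl _
  | symm a b _ ih => exact ih.symm
  | trans a b c _ _ ih₁ ih₂ => exact ih₁.trans _ _ _ ih₂

theorem Conversion.of_forall_mem {P Q : PairSet L V} (h : ∀ e ∈ P, Conversion Q e.1 e.2)
    {s t : L.Term V} (hst : Conversion P s t) : Conversion Q s t := by
  induction hst with
  | rel a b hab =>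
    obtain ⟨e, he, p, σ, hp, rfl⟩ := hab
    have := ((h e he).subst σ).context hp
    rwa [replaceAt_subtermAt_self hp] at this
  | refl a => exact EqvGen.refl _
  | symm a b _ ih => exact ih.symm
  | trans a b c _ _ ih₁ ih₂ => exact ih₁.trans _ _ _ ih₂

/-! ### Reduction orders -/

namespace IsReductionOrder

variable {gt : L.Term V → L.Term V → Prop}

theorem irrefl (hgt : IsReductionOrder gt) (s : L.Term V) : ¬ gt s s :=
  fun h => hgt.wf.asymmetric _ _ h h

theorem gt_of_stepWith (hgt : IsReductionOrder gt)
    {e : L.Term V × L.Term V} (he : gt e.1 e.2) {p : List ℕ}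
    {s t : L.Term V} (h : StepWith e p s t) : gt s t := by
  obtain ⟨σ, hp, rfl⟩ := h
  have := hgt.closed_context s p _ _ ⟨_, hp⟩ (hgt.closed_subst _ _ σ he)
  rwa [replaceAt_subtermAt_self hp] at this

theorem gt_of_rewrites (hgt : IsReductionOrder gt) {P : PairSet L V}
    (hP : ∀ e ∈ P, gt e.1 e.2) {s t : L.Term V} (h : Rewrites P s t) : gt s t := by
  obtain ⟨e, he, p, hp⟩ := h
  exact hgt.gt_of_stepWith (hP e he) hp

/-- No term is greater than a term of which it is a subterm. -/
theorem not_gt_of_subtermAt (hgt : IsReductionOrder gt) {s t : L.Term V} {p : List ℕ}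
    (hp : subtermAt t p = some s) :
    ¬ gt s t := by
  intro h
  -- replacing `s` by `t` in a term that contains `s` gives a smaller such term
  have key : ∀ a : L.Term V, ∀ q, subtermAt a q = some s → False := by
    intro a
    induction a using hgt.wf.induction with
    | _ a ih =>
      intro q hq
      refine ih (replaceAt a q t) ?_ (q ++ p) ?_
      · have := hgt.closed_context a q _ _ ⟨_, hq⟩ h
        rwa [replaceAt_subtermAt_self hq] at this
      · rw [subtermAt_append p (subtermAt_replaceAt_self t hq), hp]
  exact key s [] (subtermAt_nil s)

open scoped Classical in
/-- A variable `x` of `t` that is not in `s` could be replaced by `s`, which makes `s` greater than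
a term that contains `s`. -/
theorem vars_subset (hgt : IsReductionOrder gt) {s t : L.Term V} (h : gt s t) :
    vars t ⊆ vars s := by
  intro x hx
  by_contra hxs
  obtain ⟨p, hp⟩ := exists_subtermAt_of_mem_vars hx
  have h' := hgt.closed_subst _ _ (Function.update Language.Term.var x s) h
  have hs : s.subst (Function.update Language.Term.var x s) = s := by
    rw [subst_congr (τ := Language.Term.var), subst_var]
    intro y hy
    rw [Function.update_of_ne]
    rintro rfl
    exact hxs hy
  rw [hs] at h'
  refine hgt.not_gt_of_subtermAt (p := p) ?_ h'
  rw [subtermAt_subst _ hp]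
  simp [Language.Term.subst]

theorem not_isVar (hgt : IsReductionOrder gt) {s t : L.Term V} (h : gt s t) : ¬ IsVar s := by
  rintro ⟨x, rfl⟩
  by_cases hx : x ∈ vars t
  · obtain ⟨p, hp⟩ := exists_subtermAt_of_mem_vars hx
    exact hgt.not_gt_of_subtermAt hp h
  · have h' := hgt.closed_subst _ _ (fun _ => t) h
    have ht : t.subst (fun _ => t) = t := by
      rw [subst_congr (τ := Language.Term.var), subst_var]
      intro y hy
      have := mem_vars_var.1 (hgt.vars_subset h hy)
      exact absurd (this ▸ hy) hx
    rw [ht] at h'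
    exact hgt.irrefl t h'

end IsReductionOrder

/-! ### Inference steps and runs -/

/-- The common context and substitution of a rewrite step, as a map `f` on terms. -/
theorem StepWith.exists_map {e : L.Term V × L.Term V} {p : List ℕ} {s t : L.Term V}
    (h : StepWith e p s t) : ∃ f : L.Term V → L.Term V, f e.1 = s ∧ f e.2 = t ∧
      ∀ e' q a b, StepWith e' q a b → StepWith e' (p ++ q) (f a) (f b) := by
  obtain ⟨σ, hp, rfl⟩ := h
  exact ⟨fun w => replaceAt s p (w.subst σ), replaceAt_subtermAt_self hp, rfl,
    fun e' q a b hab => (hab.subst σ).context hp⟩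

section KBStep

variable {gt : L.Term V → L.Term V → Prop} {E R E' R' : PairSet L V} {e : L.Term V × L.Term V}

theorem KBStep.gt_of_mem (hgt : IsReductionOrder gt) (h : KBStep gt (E, R) (E', R'))
    (hR : ∀ e ∈ R, gt e.1 e.2) : ∀ e ∈ R', gt e.1 e.2 := by
  cases h with
  | deduce => exact hR
  | delete => exact hR
  | simplify_left => exact hR
  | simplify_right => exact hR
  | orient_left _ _ s t _ hst =>
    rintro e (he | rfl)
    · exact hR e he
    · exact hst
  | orient_right _ _ s t _ hst =>
    rintro e (he | rfl)
    · exact hR e he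
    · exact hst
  | compose _ _ s t u hst htu =>
    rintro e (he | rfl)
    · exact hR e he.1
    · exact hgt.trans s t u (hR _ hst)
        (hgt.gt_of_rewrites (P := R \ {(s, t)}) (fun e he => hR e he.1) htu)
  | collapse => exact fun e he => hR e he.1

theorem KBStep.conversion_of_mem (h : KBStep gt (E, R) (E', R')) :
    ∀ e ∈ E' ∪ R', Conversion (E ∪ R) e.1 e.2 := by
  have hE : ∀ e ∈ E, Conversion (E ∪ R) e.1 e.2 :=
    fun e he => EqvGen.rel _ _ (Rewrites.of_mem (.inl he))
  have hR : ∀ e ∈ R, Conversion (E ∪ R) e.1 e.2 :=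
    fun e he => EqvGen.rel _ _ (Rewrites.of_mem (.inr he))
  have hr : ∀ {a b}, Rewrites R a b → Conversion (E ∪ R) a b :=
    fun hab => EqvGen.rel _ _ (hab.mono Set.subset_union_right)
  cases h with
  | deduce _ _ s t c hs ht =>
    rintro e ((he | rfl) | he)
    · exact hE e he
    · exact (hr hs).symm.trans _ _ _ (hr ht)
    · exact hR e he
  | delete _ _ s hs =>
    rintro e (he | he)
    · exact hE e he.1
    · exact hR e he
  | simplify_left _ _ s t u hst hsu =>
    rintro e ((he | rfl) | he)
    · exact hE e he.1
    · exact (hr hsu).symm.trans _ _ _ (hE _ hst)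
    · exact hR e he
  | simplify_right _ _ s t u hst htu =>
    rintro e ((he | rfl) | he)
    · exact hE e he.1
    · exact (hE _ hst).trans _ _ _ (hr htu)
    · exact hR e he
  | orient_left _ _ s t hst =>
    rintro e (he | he | rfl)
    · exact hE e he.1
    · exact hR e he
    · exact hE _ hst
  | orient_right _ _ s t hst =>
    rintro e (he | he | rfl)
    · exact hE e he.1
    · exact hR e he
    · exact (hE _ hst).symm
  | compose _ _ s t u hst htu =>
    rintro e (he | he | rfl)
    · exact hE e he
    · exact hR e he.1
    · exact (hR _ hst).trans _ _ _ (hr (htu.mono Set.sdiff_subset))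
  | collapse _ _ t s u hts htu =>
    rintro e ((he | rfl) | he)
    · exact hE e he
    · obtain ⟨e', he', -, p, hp⟩ := htu
      exact (hr ⟨e', he'.1, p, hp⟩).symm.trans _ _ _ (hR _ hts)
    · exact hR e he.1

/-- What happens to an equation that an inference step removes. -/
theorem KBStep.equation_removed (h : KBStep gt (E, R) (E', R')) (he : e ∈ E) (he' : e ∉ E') :
    e ∈ R' ∨ e.swap ∈ R' ∨ e.1 = e.2 ∨
      (∃ u, Rewrites R e.1 u ∧ (u, e.2) ∈ E') ∨ ∃ u, Rewrites R e.2 u ∧ (e.1, u) ∈ E' := by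
  have key : ∀ {a : L.Term V × L.Term V}, e ∉ E \ {a} → e = a := fun ha => by
    by_contra hne; exact ha ⟨he, hne⟩
  cases h with
  | deduce => exact absurd (.inl he) he'
  | compose => exact absurd he he'
  | collapse => exact absurd (.inl he) he'
  | delete _ _ s => obtain rfl := key he'; exact .inr (.inr (.inl rfl))
  | orient_left _ _ s t => obtain rfl := key he'; exact .inl (.inr rfl)
  | orient_right _ _ s t => obtain rfl := key he'; exact .inr (.inl (.inr rfl))
  | simplify_left _ _ s t u _ hsu =>
    obtain rfl := key fun h => he' (.inl h)
    exact .inr (.inr (.inr (.inl ⟨u, hsu, .inr rfl⟩)))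
  | simplify_right _ _ s t u _ htu =>
    obtain rfl := key fun h => he' (.inl h)
    exact .inr (.inr (.inr (.inr ⟨u, htu, .inr rfl⟩)))

/-- What happens to a rule that an inference step removes. -/
theorem KBStep.rule_removed (h : KBStep gt (E, R) (E', R')) (he : e ∈ R) (he' : e ∉ R') :
    (∃ u, Rewrites R e.2 u ∧ (e.1, u) ∈ R') ∨
      ∃ u, RewritesProperly R e.1 u ∧ (u, e.2) ∈ E' := by
  have key : ∀ {a : L.Term V × L.Term V}, e ∉ R \ {a} → e = a := fun ha => by
    by_contra hne; exact ha ⟨he, hne⟩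
  cases h with
  | deduce => exact absurd he he'
  | delete => exact absurd he he'
  | simplify_left => exact absurd he he'
  | simplify_right => exact absurd he he'
  | orient_left => exact absurd (.inl he) he'
  | orient_right => exact absurd (.inl he) he'
  | compose _ _ s t u _ htu =>
    obtain rfl := key fun h => he' (.inl h)
    exact .inl ⟨u, htu.mono Set.sdiff_subset, .inr rfl⟩
  | collapse _ _ t s u _ htu =>
    obtain rfl := key he'
    obtain ⟨a, ha, hp⟩ := htu
    exact .inr ⟨u, ⟨a, ha.1, hp⟩, .inr rfl⟩

end KBStep

theorem persistentPairs_subset_allPairs (N : ℕ∞) (X : ℕ → PairSet L V) :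
    persistentPairs N X ⊆ allPairs N X :=
  fun _ ⟨i, hi, h⟩ => ⟨i, hi, h i le_rfl hi⟩

theorem exists_removed {N : ℕ∞} {X : ℕ → PairSet L V} {e : L.Term V × L.Term V}
    (he : e ∈ allPairs N X) (hn : e ∉ persistentPairs N X) :
    ∃ j : ℕ, (j : ℕ∞) < N ∧ e ∈ X j ∧ e ∉ X (j + 1) := by
  obtain ⟨i, hi, hei⟩ := he
  by_contra! hcon
  refine hn ⟨i, hi, fun j hij => ?_⟩
  induction j, hij using Nat.le_induction with
  | base => exact fun _ => hei
  | succ j _ ih =>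
    intro hj
    have hlt : (j : ℕ∞) < N := lt_of_lt_of_le (by exact_mod_cast Nat.lt_succ_self j) hj
    exact hcon j hlt (ih hlt.le)

section Run

variable {gt : L.Term V → L.Term V → Prop} {N : ℕ∞} {E R : ℕ → PairSet L V}

theorem add_one_le_of_coe_lt {j : ℕ} (h : (j : ℕ∞) < N) : ((j + 1 : ℕ) : ℕ∞) ≤ N := by
  push_cast
  exact Order.add_one_le_of_lt h

theorem IsRun.gt_of_mem_allPairs (hgt : IsReductionOrder gt) (hrun : IsRun gt N E R) :
    ∀ e ∈ allPairs N R, gt e.1 e.2 := by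
  rintro e ⟨i, hi, he⟩
  induction i generalizing e with
  | zero => rw [hrun.init] at he; exact absurd he (Set.notMem_empty e)
  | succ i ih =>
    have hlt : (i : ℕ∞) < N := lt_of_lt_of_le (by exact_mod_cast Nat.lt_succ_self i) hi
    exact (hrun.step i hlt).gt_of_mem hgt (fun e he => ih e hlt.le he) e he

/-- Soundness of the inference steps. -/
theorem IsRun.conversion_of_mem (hrun : IsRun gt N E R) {i : ℕ} (hi : (i : ℕ∞) ≤ N) :
    ∀ e ∈ E i ∪ R i, Conversion (E 0) e.1 e.2 := by
  induction i with
  | zero =>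
    rw [hrun.init, Set.union_empty]
    exact fun e he => EqvGen.rel _ _ (Rewrites.of_mem he)
  | succ i ih =>
    have hlt : (i : ℕ∞) < N := lt_of_lt_of_le (by exact_mod_cast Nat.lt_succ_self i) hi
    exact fun e he => Conversion.of_forall_mem (ih hlt.le)
      ((hrun.step i hlt).conversion_of_mem e he)

/-- The terms that are at most one of two given terms. -/
def BelowOr (gt : L.Term V → L.Term V → Prop) (s t w : L.Term V) : Prop :=
  (w = s ∨ gt s w) ∨ (w = t ∨ gt t w)

theorem BelowOr.symm {s t w : L.Term V} (h : BelowOr gt s t w) : BelowOr gt t s w := Or.symm h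

theorem BelowOr.trans (hgt : IsReductionOrder gt) {s t a b w : L.Term V} (h : BelowOr gt a b w)
    (ha : BelowOr gt s t a) (hb : BelowOr gt s t b) : BelowOr gt s t w := by
  have aux : ∀ {c}, BelowOr gt s t c → (w = c ∨ gt c w) → BelowOr gt s t w := by
    rintro c hc (rfl | hw)
    · exact hc
    · rcases hc with (rfl | hc) | (rfl | hc)
      · exact .inl (.inr hw)
      · exact .inl (.inr (hgt.trans _ _ _ hc hw))
      · exact .inr (.inr hw)
      · exact .inr (.inr (hgt.trans _ _ _ hc hw))
  exact h.elim (aux ha) (aux hb)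

/-- The well-founded order on the costs of steps: a step with an equation between `s` and `t`
has the multiset `{s, t}` as its first component; a step `s → t` with a rule `ℓ → r` costs `{s}`,
then the size of `ℓ` and its excess over the number of variables of `ℓ`, then `t`. -/
abbrev CostLT (gt : L.Term V → L.Term V → Prop) :
    Multiset (L.Term V) × (ℕ × ℕ) × L.Term V → Multiset (L.Term V) × (ℕ × ℕ) × L.Term V → Prop :=
  Prod.Lex (CutExpand fun b a => gt a b) (Prod.Lex (Prod.Lex (· < ·) (· < ·)) fun b a => gt a b)

theorem wellFounded_costLT (hgt : IsReductionOrder gt) : WellFounded (CostLT gt) := by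
  have : Std.Irrefl fun b a => gt a b := ⟨hgt.irrefl⟩
  exact hgt.wf.cutExpand.prod_lex ((wellFounded_lt.prod_lex wellFounded_lt).prod_lex hgt.wf)

/-- A step with an equation or a rule that occurs in the run is simulated by a conversion with
persistent rules through terms that are at most one of its two sides. A pair that does not persist
is removed at some point, and the inference step that removes it replaces the given step by steps
of smaller cost. -/
theorem IsRun.conversionIn_of_stepWith (hgt : IsReductionOrder gt) (hrun : IsRun gt N E R)
    (hE : persistentPairs N E = ∅) {e : L.Term V × L.Term V} {p : List ℕ} {s t : L.Term V}
    (he : e ∈ allPairs N E ∪ allPairs N R) (h : StepWith e p s t) :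
    ConversionIn (BelowOr gt s t) (persistentPairs N R) s t := by
  have hR := hrun.gt_of_mem_allPairs hgt
  have key : ∀ c : Multiset (L.Term V) × (ℕ × ℕ) × L.Term V, ∀ e p s t, StepWith e p s t →
      (e ∈ allPairs N E ∧ c.1 = {s, t} ∨
        e ∈ allPairs N R ∧ c = ({s}, (size e.1, size e.1 - (vars e.1).card), t)) →
      ConversionIn (BelowOr gt s t) (persistentPairs N R) s t := by
    intro c
    induction c using (wellFounded_costLT hgt).induction with
    | _ c ih =>
    intro e p s t h hc
    have ihE : ∀ {e p a b}, e ∈ allPairs N E → StepWith e p a b →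
        CutExpand (fun b a => gt a b) {a, b} c.1 → BelowOr gt s t a → BelowOr gt s t b →
        ConversionIn (BelowOr gt s t) (persistentPairs N R) a b := by
      intro e p a b he hab hlt ha hb
      exact (ih ({a, b}, c.2) (Prod.Lex.left _ _ hlt) e p a b hab (.inl ⟨he, rfl⟩)).mono
        fun w hw => hw.trans hgt ha hb
    have ihR : ∀ {a b}, Rewrites (allPairs N R) a b →
        CutExpand (fun b a => gt a b) {a} c.1 → BelowOr gt s t a →
        ConversionIn (BelowOr gt s t) (persistentPairs N R) a b := by
      rintro a b ⟨e, he, p, hab⟩ hlt ha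
      exact (ih (_, _, _) (Prod.Lex.left _ _ hlt) e p a b hab (.inr ⟨he, rfl⟩)).mono
        fun w hw => hw.trans hgt ha
          (BelowOr.trans hgt (.inl (.inr (hgt.gt_of_stepWith (hR e he) hab))) ha ha)
    obtain ⟨f, rfl, rfl, hf⟩ := h.exists_map
    have hfgt : ∀ {a b}, gt a b → gt (f a) (f b) := fun hab =>
      hgt.gt_of_stepWith hab (hf _ _ _ _ (stepWith_self (_, _)))
    have hfR : ∀ {j : ℕ} {a b}, (j : ℕ∞) ≤ N → Rewrites (R j) a b →
        Rewrites (allPairs N R) (f a) (f b) := by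
      rintro j a b hj ⟨e, he, p, hp⟩
      exact ⟨e, ⟨j, hj, he⟩, _, hf _ _ _ _ hp⟩
    set s := f e.1 with hs
    set t := f e.2 with ht
    have hss : BelowOr gt s t s := .inl (.inl rfl)
    have htt : BelowOr gt s t t := .inr (.inl rfl)
    rcases hc with ⟨he, hc⟩ | ⟨he, hc⟩
    · obtain ⟨j, hj, hej, hej'⟩ := exists_removed he (by simp [hE])
      have hj' := add_one_le_of_coe_lt hj
      -- a rule step costs a singleton, which is less than the pair of an equation step
      have hcs : CutExpand (fun b a => gt a b) {s} c.1 :=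
        ⟨0, t, by simp, by rw [hc, add_zero]; rfl⟩
      have hct : CutExpand (fun b a => gt a b) {t} c.1 :=
        ⟨0, s, by simp, by rw [hc, add_zero, add_comm]; rfl⟩
      rcases (hrun.step j hj).equation_removed hej hej' with
        h₁ | h₁ | h₁ | ⟨u, hu, h₁⟩ | ⟨u, hu, h₁⟩
      · exact ihR ⟨e, ⟨_, hj', h₁⟩, p, h⟩ hcs hss
      · exact (ihR ⟨e.swap, ⟨_, hj', h₁⟩, p, h.swap⟩ hct htt).symm
      · rw [hs, ht, h₁]
        exact ConversionIn.refl _ _ _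
      · have hsu := hfR hj.le hu
        have hgsu := hgt.gt_of_rewrites hR hsu
        refine (ihR hsu hcs hss).trans (ihE ⟨_, hj', h₁⟩ (hf _ _ _ _ (stepWith_self _)) ?_
          (.inl (.inr hgsu)) htt)
        exact ⟨{f u}, s, by simpa using hgsu, by
          rw [hc]; simp only [Multiset.insert_eq_cons, ← Multiset.singleton_add]; abel⟩
      · have htu := hfR hj.le hu
        have hgtu := hgt.gt_of_rewrites hR htu
        refine ConversionIn.trans ?_ (ihR htu hct htt).symm
        refine ihE ⟨_, hj', h₁⟩ (hf _ _ _ _ (stepWith_self _)) ?_ hss (.inr (.inr hgtu))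
        exact ⟨{f u}, t, by simpa using hgtu, by
          rw [hc]; simp only [Multiset.insert_eq_cons, ← Multiset.singleton_add]; abel⟩
    · have hst : gt s t := hfgt (hR e he)
      by_cases hpers : e ∈ persistentPairs N R
      · exact ConversionIn.single ⟨e, hpers, p, h⟩ hss htt
      obtain ⟨j, hj, hej, hej'⟩ := exists_removed he hpers
      have hj' := add_one_le_of_coe_lt hj
      have hc₁ : c.1 = {s} := by rw [hc]
      rcases (hrun.step j hj).rule_removed hej hej' with
        ⟨u, hu, h₁⟩ | ⟨u, ⟨e', he', henc, q, hq⟩, h₁⟩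
      · have htu := hfR hj.le hu
        have hgtu := hgt.gt_of_rewrites hR htu
        refine ConversionIn.trans (t := f u) ?_
          (ihR htu (by rw [hc₁]; exact cutExpand_singleton_singleton hst) htt).symm
        · refine (ih (_, _, f u) ?_ _ _ s (f u) (hf _ _ _ _ (stepWith_self (e.1, u)))
            (.inr ⟨⟨_, hj', h₁⟩, rfl⟩)).mono fun w hw => hw.trans hgt hss (.inr (.inr hgtu))
          rw [hc]
          exact Prod.Lex.right _ (Prod.Lex.right _ hgtu)
      · have hsu := hf _ _ _ _ hq
        have hgsu : gt s (f u) := hgt.gt_of_stepWith (hR e' ⟨j, hj.le, he'⟩) hsu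
        refine ConversionIn.trans (t := f u) ?_
          (ihE ⟨_, hj', h₁⟩ (hf _ _ _ _ (stepWith_self _)) ?_ (.inl (.inr hgsu)) htt)
        · refine (ih (_, _, f u) ?_ _ _ s (f u) hsu
            (.inr ⟨⟨j, hj.le, he'⟩, rfl⟩)).mono fun w hw => hw.trans hgt hss (.inl (.inr hgsu))
          rw [hc]
          refine Prod.Lex.right _ (Prod.Lex.left _ _ ?_)
          rcases henc.size_lt_or with hlt | ⟨heq, hlt⟩
          · exact Prod.Lex.left _ _ hlt
          · rw [heq] at hlt ⊢
            exact Prod.Lex.right _ hlt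
        · rw [hc₁]
          refine cutExpand_singleton ?_
          simp only [Multiset.insert_eq_cons, Multiset.mem_cons, Multiset.mem_singleton]
          rintro a (rfl | rfl)
          · exact hgsu
          · exact hst
  rcases he with he | he
  · exact key ({s, t}, (0, 0), s) e p s t h (.inl ⟨he, rfl⟩)
  · exact key _ e p s t h (.inr ⟨he, rfl⟩)

end Run

/-! ### Peaks -/

section Peaks

variable {gt : L.Term V → L.Term V → Prop} {R : PairSet L V}

theorem conversionIn_of_joinable (hgt : IsReductionOrder gt) (hR : ∀ e ∈ R, gt e.1 e.2)
    {s t u : L.Term V} (ht : gt s t) (hu : gt s u) (h : Joinable R t u) :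
    ConversionIn (gt s) R t u := by
  obtain ⟨w, htw, huw⟩ := h
  have hM : ∀ a b, gt s a → Rewrites R a b → gt s b :=
    fun a b ha hab => hgt.trans _ _ _ ha (hgt.gt_of_rewrites hR hab)
  exact (ConversionIn.of_reflTransGen htw ht hM).2.trans
    (ConversionIn.of_reflTransGen huw hu hM).2.symm

/-- A peak whose inner step takes place at or below a variable position of the left-hand side of
the outer step is joinable. -/
theorem joinable_of_variable_overlap {e : L.Term V × L.Term V} (he : e ∈ R)
    {σ : V → L.Term V} {x : V} {p₁ p₂ : List ℕ} {w v : L.Term V}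
    (hp₁ : subtermAt e.1 p₁ = some (.var x)) (hp₂ : subtermAt (σ x) p₂ = some w)
    (hwv : Rewrites R w v) :
    Joinable R (replaceAt (e.1.subst σ) (p₁ ++ p₂) v) (e.2.subst σ) := by
  classical
  set τ := Function.update σ x (replaceAt (σ x) p₂ v) with hτ
  have hstep : ∀ y, ReflTransGen (Rewrites R) (σ y) (τ y) := by
    intro y
    by_cases hy : y = x
    · subst hy
      rw [hτ, Function.update_self]
      refine ReflTransGen.single ?_
      have := hwv.context hp₂
      rwa [replaceAt_subtermAt_self hp₂] at this
    · rw [hτ, Function.update_of_ne hy]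
  refine ⟨e.2.subst τ, ?_, reflTransGen_rewrites_subst _ hstep⟩
  have hx : replaceAt (σ x) p₂ v = τ x := by rw [hτ, Function.update_self]
  rw [replaceAt_append p₂ v (subtermAt_subst σ hp₁)]
  change ReflTransGen _ (replaceAt _ p₁ (replaceAt (σ x) p₂ v)) _
  rw [hx]
  exact (reflTransGen_rewrites_replaceAt_subst hp₁ hstep).tail
    ((Rewrites.of_mem (s := e.1) (t := e.2) he).subst τ)

/-- A peak at a function symbol position `p` of the left-hand side of the outer rule, with a redex
at `p` whose proper subterms are normal forms, is an instance of a prime critical peak, or its two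
sides agree. -/
theorem eq_or_exists_prime_critical_peak [Infinite V]
    (hvars : ∀ e ∈ R, vars e.2 ⊆ vars e.1) {e₁ e₂ : L.Term V × L.Term V} (he₁ : e₁ ∈ R)
    (he₂ : e₂ ∈ R) {σ₁ σ₂ : V → L.Term V} {p : List ℕ} {v : L.Term V}
    (hp : subtermAt e₂.1 p = some v) (hv : ¬ IsVar v) (hσ : v.subst σ₂ = e₁.1.subst σ₁)
    (hnf : ∀ q w, q ≠ [] → subtermAt (v.subst σ₂) q = some w → IsNormalForm R w) :
    replaceAt (e₂.1.subst σ₂) p (e₁.2.subst σ₁) = e₂.2.subst σ₂ ∨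
      ∃ (t s u : L.Term V) (δ : V → L.Term V), IsPrimeCriticalPeak R t p s u ∧
        s.subst δ = e₂.1.subst σ₂ ∧ t.subst δ = replaceAt (e₂.1.subst σ₂) p (e₁.2.subst σ₁) ∧
        u.subst δ = e₂.2.subst σ₂ := by
  classical
  obtain ⟨ρ, hρ⟩ := exists_perm_disjoint (pairVars e₁) (pairVars e₂)
  set e : L.Term V × L.Term V := (e₁.1.relabel ρ, e₁.2.relabel ρ) with he
  have hmem : ∀ x ∈ pairVars e, ∃ y ∈ pairVars e₁, ρ y = x := by
    intro x hx
    rcases Finset.mem_union.1 hx with hx | hx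
    · obtain ⟨y, hy, rfl⟩ := mem_vars_relabel.1 hx
      exact ⟨y, Finset.mem_union_left _ hy, rfl⟩
    · obtain ⟨y, hy, rfl⟩ := mem_vars_relabel.1 hx
      exact ⟨y, Finset.mem_union_right _ hy, rfl⟩
  -- the two substitutions combined, the inner rule being renamed by `ρ`
  set τ : V → L.Term V := fun x => if x ∈ pairVars e₂ then σ₂ x else σ₁ (ρ.symm x) with hτ
  have hτ₁ : ∀ t : L.Term V, vars t ⊆ pairVars e₁ → (t.relabel ρ).subst τ = t.subst σ₁ := by
    intro t ht
    rw [subst_relabel]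
    refine subst_congr fun x hx => ?_
    simp only [hτ, Function.comp, if_neg (hρ x (ht hx)), Equiv.symm_apply_apply]
  have hτ₂ : ∀ t : L.Term V, vars t ⊆ pairVars e₂ → t.subst τ = t.subst σ₂ := by
    intro t ht
    refine subst_congr fun x hx => ?_
    simp only [hτ, if_pos (ht hx)]
  have hτ₁l : e.1.subst τ = e₁.1.subst σ₁ := hτ₁ _ Finset.subset_union_left
  have hτ₁r : e.2.subst τ = e₁.2.subst σ₁ := hτ₁ _ Finset.subset_union_right
  have hτ₂l : e₂.1.subst τ = e₂.1.subst σ₂ := hτ₂ _ Finset.subset_union_left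
  have hτ₂r : e₂.2.subst τ = e₂.2.subst σ₂ := hτ₂ _ Finset.subset_union_right
  have hτv : v.subst τ = v.subst σ₂ := by
    have h₁ := subtermAt_subst τ hp
    rw [hτ₂l, subtermAt_subst σ₂ hp] at h₁
    exact (Option.some.inj h₁).symm
  have hunif : IsUnifier τ e.1 v := by rw [IsUnifier, hτ₁l, hτv, hσ]
  by_cases hvar : p = [] ∧ AreVariants e e₂
  · left
    obtain ⟨rfl, π, h₁, h₂⟩ := hvar
    simp only [subtermAt_nil, Option.some.injEq] at hp
    subst hp
    rw [replaceAt_nil, ← hτ₁r, ← hτ₂r, h₂, subst_relabel e.2 π τ]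
    have heq : e.1.subst τ = e.1.subst (τ ∘ π) := by rw [← subst_relabel, ← h₁]; exact hunif
    refine subst_congr fun x hx => eqOn_vars_of_subst_eq heq x ?_
    obtain ⟨y, hy, rfl⟩ := mem_vars_relabel.1 hx
    exact mem_vars_relabel.2 ⟨y, hvars _ he₁ hy, rfl⟩
  · right
    obtain ⟨σ, hmgu⟩ := exists_isMGU hunif
    obtain ⟨δ, hδ⟩ := hmgu.2 τ hunif
    have hδ' : ∀ t : L.Term V, (t.subst σ).subst δ = t.subst τ := fun t => by
      rw [subst_subst]
      exact (subst_congr fun x _ => hδ x).symm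
    refine ⟨replaceAt (e₂.1.subst σ) p (e.2.subst σ), e₂.1.subst σ, e₂.2.subst σ, δ,
      ⟨⟨e, e₂, σ, v, ⟨?_, ?_, ?_, ⟨v, hp, hv⟩, ⟨v, hp, τ, hunif⟩, fun hp hvv => hvar ⟨hp, hvv⟩⟩,
        hp, hmgu, rfl, rfl, rfl⟩, ?_⟩, ?_, ?_, ?_⟩
    · refine ⟨e₁, he₁, ρ.symm, ?_, ?_⟩ <;> simp [he]
    · refine ⟨e₂, he₂, 1, ?_, ?_⟩ <;> exact (Language.Term.relabel_id _).symm
    · rw [Finset.disjoint_left]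
      intro x hx
      obtain ⟨y, hy, rfl⟩ := hmem x hx
      exact hρ y hy
    · intro q w hq hw
      rw [subtermAt_append q (subtermAt_subst σ hp)] at hw
      have h₁ := subtermAt_subst δ hw
      rw [hδ', hτv] at h₁
      exact (hnf q _ hq h₁).of_subst
    · rw [hδ', hτ₂l]
    · rw [replaceAt_subst _ _ (subtermAt_subst σ hp), hδ', hδ', hτ₂l, hτ₁r]
    · rw [hδ', hτ₂r]

/-- A peak with an innermost inner step, below a step at the root. -/
theorem conversionIn_of_innermost_peak [Infinite V] (hgt : IsReductionOrder gt)
    (hR : ∀ e ∈ R, gt e.1 e.2)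
    (hpcp : ∀ t p s u, IsPrimeCriticalPeak R t p s u → ConversionIn (gt s) R t u)
    {e₁ e₂ : L.Term V × L.Term V} (he₁ : e₁ ∈ R) (he₂ : e₂ ∈ R) {p : List ℕ}
    {s t u w : L.Term V} (ht : StepWith e₁ p s t) (hu : StepWith e₂ [] s u)
    (hw : subtermAt s p = some w)
    (hnf : ∀ q w', q ≠ [] → subtermAt w q = some w' → IsNormalForm R w') :
    ConversionIn (gt s) R t u := by
  have hst := hgt.gt_of_stepWith (hR e₁ he₁) ht
  have hsu := hgt.gt_of_stepWith (hR e₂ he₂) hu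
  obtain ⟨σ₁, h₁, rfl⟩ := ht
  obtain ⟨σ₂, h₂, rfl⟩ := hu
  simp only [subtermAt_nil, Option.some.injEq] at h₂
  subst h₂
  rw [replaceAt_nil] at hsu ⊢
  obtain rfl : w = e₁.1.subst σ₁ := Option.some.inj (hw.symm.trans h₁)
  rcases mem_funPositions_or_of_subtermAt_subst h₁ with ⟨v, hv, hv'⟩ | ⟨p₁, p₂, x, rfl, hx, hp₂⟩
  · have hσ : v.subst σ₂ = e₁.1.subst σ₁ :=
      Option.some.inj ((subtermAt_subst σ₂ hv).symm.trans h₁)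
    rcases eq_or_exists_prime_critical_peak (fun e he => hgt.vars_subset (hR e he)) he₁ he₂ hv hv'
      hσ (by rwa [hσ]) with heq | ⟨t, s, u, δ, hpeak, hs, ht, hu⟩
    · rw [heq]
      exact ConversionIn.refl _ _ _
    · rw [← ht, ← hu, ← hs]
      exact (hpcp t p s u hpeak).lift (fun w => w.subst δ) (fun _ _ h => h.subst δ)
        fun _ h => hgt.closed_subst _ _ δ h
  · exact conversionIn_of_joinable hgt hR hst hsu (joinable_of_variable_overlap he₂ hx hp₂
      ((Rewrites.of_mem (s := e₁.1) (t := e₁.2) he₁).subst σ₁))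

/-- A reducible term has an innermost redex. -/
theorem exists_innermost_redex {s t : L.Term V} (h : Rewrites R s t) :
    ∃ e ∈ R, ∃ q u w, StepWith e q s u ∧ subtermAt s q = some w ∧
      ∀ q' w', q' ≠ [] → subtermAt w q' = some w' → IsNormalForm R w' := by
  induction hn : size s using Nat.strong_induction_on generalizing s t with
  | _ n ih =>
  subst hn
  by_cases hsub : ∀ q w, q ≠ [] → subtermAt s q = some w → IsNormalForm R w
  · obtain ⟨e, he, q, hq⟩ := h
    have hq0 : q = [] := by
      by_contra hq0
      obtain ⟨σ, hσ, -⟩ := hq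
      exact hsub q _ hq0 hσ _ ((Rewrites.of_mem (s := e.1) (t := e.2) he).subst σ)
    subst hq0
    exact ⟨e, he, [], t, s, hq, subtermAt_nil s, hsub⟩
  · simp only [IsNormalForm, not_forall, not_not] at hsub
    obtain ⟨q, w, hq, hw, v, hwv⟩ := hsub
    obtain ⟨e, he, q', u, w', h₁, h₂, h₃⟩ := ih _ (size_lt_of_subtermAt hw hq) hwv rfl
    refine ⟨e, he, q ++ q', replaceAt s q u, w', ?_, by rw [subtermAt_append q' hw, h₂], h₃⟩
    have := h₁.context hw
    rwa [replaceAt_subtermAt_self hw] at this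

/-- A peak with one step at the root. If the inner step at `p` is not innermost, then a third,
innermost step strictly below `p` splits the peak into two peaks with innermost inner steps. -/
theorem conversionIn_of_root_peak [Infinite V] (hgt : IsReductionOrder gt)
    (hR : ∀ e ∈ R, gt e.1 e.2)
    (hpcp : ∀ t p s u, IsPrimeCriticalPeak R t p s u → ConversionIn (gt s) R t u)
    {e₁ e₂ : L.Term V × L.Term V} (he₁ : e₁ ∈ R) (he₂ : e₂ ∈ R) {p : List ℕ}
    {s t u : L.Term V} (ht : StepWith e₁ p s t) (hu : StepWith e₂ [] s u) :
    ConversionIn (gt s) R t u := by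
  obtain ⟨σ₁, hp, rfl⟩ := ht
  obtain ⟨e, he, q, v, w, hv, hw, hnf⟩ := exists_innermost_redex
    ((Rewrites.of_mem (s := e₁.1) (t := e₁.2) he₁).subst σ₁)
  have hroot : StepWith e₁ [] (e₁.1.subst σ₁) (e₁.2.subst σ₁) :=
    (stepWith_self e₁).subst σ₁
  have h₁ := conversionIn_of_innermost_peak hgt hR hpcp he he₁ hv hroot hw hnf
  have hctx := hv.context hp
  rw [replaceAt_subtermAt_self hp] at hctx
  have h₂ := conversionIn_of_innermost_peak hgt hR hpcp he he₂ hctx hu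
    (by rw [subtermAt_append q hp, hw]) hnf
  refine ConversionIn.trans ?_ h₂
  refine (h₁.lift (fun w => replaceAt s p w) (fun _ _ h => h.context hp) fun a ha => ?_).symm
  have := hgt.closed_context s p _ _ ⟨_, hp⟩ ha
  rwa [replaceAt_subtermAt_self hp] at this

theorem conversionIn_of_peak [Infinite V] (hgt : IsReductionOrder gt)
    (hR : ∀ e ∈ R, gt e.1 e.2)
    (hpcp : ∀ t p s u, IsPrimeCriticalPeak R t p s u → ConversionIn (gt s) R t u)
    {s t u : L.Term V} (ht : Rewrites R s t) (hu : Rewrites R s u) :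
    ConversionIn (gt s) R t u := by
  obtain ⟨e₁, he₁, p, hp⟩ := ht
  obtain ⟨e₂, he₂, q, hq⟩ := hu
  induction p generalizing q s t u with
  | nil => exact (conversionIn_of_root_peak hgt hR hpcp he₂ he₁ hq hp).symm
  | cons i p ih =>
    match q, hq with
    | [], hq => exact conversionIn_of_root_peak hgt hR hpcp he₁ he₂ hp hq
    | j :: q, hq =>
      have hst := hgt.gt_of_stepWith (hR e₁ he₁) hp
      have hsu := hgt.gt_of_stepWith (hR e₂ he₂) hq
      obtain ⟨σ₁, h₁, rfl⟩ := hp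
      obtain ⟨σ₂, h₂, rfl⟩ := hq
      obtain ⟨n, f, ts, i, rfl, rfl, h₁'⟩ := exists_func_of_subtermAt_cons h₁
      obtain ⟨n', f', ts', j, heq, rfl, h₂'⟩ := exists_func_of_subtermAt_cons h₂
      cases heq
      rw [replaceAt_func_cons] at hst hsu
      rw [replaceAt_func_cons, replaceAt_func_cons]
      by_cases hij : i = j
      · subst hij
        have hpos : subtermAt (.func f ts) [i.1] = some (ts i) := by
          rw [subtermAt_func_cons, subtermAt_nil]
        have := (ih (s := ts i) ⟨σ₁, h₁', rfl⟩ q ⟨σ₂, h₂', rfl⟩).lift (M' := gt (.func f ts))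
          (fun w => replaceAt (.func f ts) [i.1] w) (fun _ _ h => h.context hpos) fun a ha => by
            have := hgt.closed_context (.func f ts) [i.1] _ _ ⟨_, hpos⟩ ha
            rwa [replaceAt_subtermAt_self hpos] at this
        simpa only [replaceAt_func_cons, replaceAt_nil] using this
      · -- the two steps take place in different arguments and commute
        refine conversionIn_of_joinable hgt hR hst hsu
          ⟨_, .single (Rewrites.func f (i := j) (t := replaceAt (ts j) q (e₂.2.subst σ₂)) ?_), ?_⟩
        · rw [Function.update_of_ne (Ne.symm hij)]
          exact ⟨e₂, he₂, q, σ₂, h₂', rfl⟩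
        · rw [Function.update_comm hij]
          refine .single (Rewrites.func f ?_)
          rw [Function.update_of_ne hij]
          exact ⟨e₁, he₁, p, σ₁, h₁', rfl⟩

theorem gt_of_areVariants {gt : L.Term V → L.Term V → Prop} (hgt : IsReductionOrder gt)
    {e e' : L.Term V × L.Term V} (h : AreVariants e e') (he' : gt e'.1 e'.2) : gt e.1 e.2 := by
  obtain ⟨π, h₁, h₂⟩ := h
  have := hgt.closed_subst _ _ (Language.Term.var ∘ π.symm) he'
  rw [h₁, h₂, subst_relabel, subst_relabel, Function.comp_assoc, Equiv.symm_comp_self,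
    Function.comp_id, subst_var, subst_var] at this
  exact this

theorem IsCriticalPeak.gt_and_gt (hgt : IsReductionOrder gt) (hR : ∀ e ∈ R, gt e.1 e.2)
    {s t u : L.Term V} {p : List ℕ} (h : IsCriticalPeak R t p s u) : gt s t ∧ gt s u := by
  obtain ⟨e₁, e₂, σ, v, ho, hv, hσ, rfl, rfl, rfl⟩ := h
  obtain ⟨e, he, h₁⟩ := ho.variant₁
  obtain ⟨e', he', h₂⟩ := ho.variant₂
  refine ⟨hgt.gt_of_stepWith (gt_of_areVariants hgt h₁ (hR e he)) ⟨σ, ?_, rfl⟩,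
    hgt.closed_subst _ _ σ (gt_of_areVariants hgt h₂ (hR e' he'))⟩
  rw [subtermAt_subst σ hv]
  exact congrArg some hσ.1.symm

end Peaks

/-! ### Confluence -/

/-- If the two sides of every peak are connected by a conversion through terms smaller than its
source, then the rewrite relation is confluent. -/
theorem isConfluent_of_conversionIn_peak {gt : L.Term V → L.Term V → Prop} {R : PairSet L V}
    (hgt : IsReductionOrder gt) (hR : ∀ e ∈ R, gt e.1 e.2)
    (h : ∀ s t u, Rewrites R s t → Rewrites R s u → ConversionIn (gt s) R t u) :
    IsConfluent R := by
  intro s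
  induction s using hgt.wf.induction with
  | _ s ih =>
    have hjoin : ∀ {t u}, gt s t → ConversionIn (gt s) R t u → Joinable R t u := by
      intro t u _ htu
      induction htu with
      | refl => exact ⟨t, .refl, .refl⟩
      | tail _ hab ih' =>
        obtain ⟨w, h₁, h₂⟩ := ih'
        obtain ⟨hab | hab, ha, -⟩ := hab
        · obtain ⟨w', h₃, h₄⟩ := ih _ ha _ _ h₂ (.single hab)
          exact ⟨w', h₁.trans h₃, h₄⟩
        · exact ⟨w, h₁, h₂.head hab⟩
    intro t u ht hu
    rcases ht.cases_head with rfl | ⟨t', hst, ht⟩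
    · exact ⟨u, hu, .refl⟩
    rcases hu.cases_head with rfl | ⟨u', hsu, hu⟩
    · exact ⟨t, .refl, ht.head hst⟩
    have hgt' := hgt.gt_of_rewrites hR hst
    have hgu' := hgt.gt_of_rewrites hR hsu
    obtain ⟨w, h₁, h₂⟩ := hjoin hgt' (h s t' u' hst hsu)
    obtain ⟨a, h₃, h₄⟩ := ih t' hgt' t w ht h₁
    obtain ⟨b, h₅, h₆⟩ := ih u' hgu' a u (h₂.trans h₄) hu
    exact ⟨b, h₃.trans h₅, h₆⟩

end TermRewriting

/-! ### Completeness of fair runs -/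

open TermRewriting Relation in
theorem mainTheorem2 {L : FirstOrder.Language.{u, v}} {V : Type w} [Infinite V]
    (gt : L.Term V → L.Term V → Prop) (hgt : TermRewriting.IsReductionOrder gt)
    (N : ℕ∞) (E R : ℕ → TermRewriting.PairSet L V)
    (hrun : TermRewriting.IsRun gt N E R) (hfair : TermRewriting.IsFair N E R) :
    TermRewriting.IsCompletePresentation (TermRewriting.persistentPairs N R) (E 0) := by
  have hR : ∀ e ∈ persistentPairs N R, gt e.1 e.2 := fun e he =>
    hrun.gt_of_mem_allPairs hgt e (persistentPairs_subset_allPairs N R he)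
  have hstep : ∀ {s t}, Rewrites (allPairs N E) s t →
      ConversionIn (BelowOr gt s t) (persistentPairs N R) s t := by
    rintro s t ⟨e, he, p, hp⟩
    exact hrun.conversionIn_of_stepWith hgt hfair.no_persistent_equation (.inl he) hp
  refine ⟨fun e he => ⟨hgt.not_isVar (hR e he), hgt.vars_subset (hR e he)⟩, ?_, ?_, ?_⟩
  · exact Subrelation.wf (fun h => hgt.gt_of_rewrites hR h) hgt.wf
  · suffices hpcp : ∀ t p s u, IsPrimeCriticalPeak (persistentPairs N R) t p s u →
        ConversionIn (gt s) (persistentPairs N R) t u from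
      isConfluent_of_conversionIn_peak hgt hR fun _ _ _ => conversionIn_of_peak hgt hR hpcp
    intro t p s u hpeak
    obtain ⟨hst, hsu⟩ : gt s t ∧ gt s u := hpeak.1.gt_and_gt hgt hR
    rcases hfair.prime_critical_pairs t u ⟨p, s, hpeak⟩ with hj | htu | hut
    · exact conversionIn_of_joinable hgt hR hst hsu hj
    · refine (hstep htu).mono ?_
      rintro w ((rfl | hw) | (rfl | hw))
      exacts [hst, hgt.trans _ _ _ hst hw, hsu, hgt.trans _ _ _ hsu hw]
    · refine (hstep hut).symm.mono ?_
      rintro w ((rfl | hw) | (rfl | hw))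
      exacts [hsu, hgt.trans _ _ _ hsu hw, hst, hgt.trans _ _ _ hst hw]
  · intro s t
    constructor
    · refine fun h => Conversion.of_forall_mem (fun e he => ?_) h
      obtain ⟨i, hi, he⟩ := he
      exact hrun.conversion_of_mem hi e (.inr (he i le_rfl hi))
    · refine fun h => Conversion.of_forall_mem (fun e he => ?_) h
      exact (hstep (Rewrites.of_mem ⟨0, by simp, he⟩)).conversion
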